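/- Let $n\ge 1$, let $|\cdot|$ denote volume in the appropriate dimension, let $B_2^n$ be the Euclidean unit ball of $\mathbb R^n$, and put $c_n=|B_2^n|^{\frac{n-1}{n}}/|B_2^{n-1}|$. A convex body is a compact convex set with nonempty interior; $K|\xi^\perp$ is the orthogonal projection of $K$ to the hyperplane $\xi^\perp$ orthogonal to $\xi\in S^{n-1}$; and a convex body $L$ is a projection body if there is a convex body $M\subset\mathbb R^n$ such that the support function $h_L(\theta)=\max_{y\in L}\langle\theta,y\rangle$ satisfies $h_L(\theta)=|M|\theta^\perp|$ for every $\theta\in S^{n-1}$. Suppose that $\varepsilon>0$, that $K$ and $L$ are origin-symmetric convex bodies in $\mathbb R^n$, and that $L$ is a projection body. If $$|K|\xi^\perp|\le |L|\xi^\perp|-\varepsilon\qquad\text{for every }\xi\in S^{n-1},$$ then $$|K|^{\frac{n-1}{n}}\le |L|^{\frac{n-1}{n}}-c_n\,\varepsilon .$$ Moreover, for $n\ge 2$ the constant $c_n$ is the best possible: if a real number $c$ is such that $|K|^{\frac{n-1}{n}}\le |L|^{\frac{n-1}{n}}-c\,\varepsilon$ for all $\varepsilon$, $K$, $L$ as above,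 then $c\le c_n$. -/

import Mathlib

open MeasureTheory

noncomputable section

/-- A compact convex set is a convex body in the sense of convex geometry when it has interior
points; `ConvexBody` alone only asks for a nonempty compact convex set. -/
def ConvexBody.HasInterior {n : ℕ} (K : ConvexBody (EuclideanSpace ℝ (Fin n))) : Prop :=
  (interior (K : Set (EuclideanSpace ℝ (Fin n)))).Nonempty

/-- Symmetry with respect to the origin, `K = -K`. -/
def ConvexBody.OriginSymmetric {n : ℕ} (K : ConvexBody (EuclideanSpace ℝ (Fin n))) : Prop :=
  ∀ x ∈ K, -x ∈ K

/-- The `n`-dimensional volume `|K|`. -/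
def ConvexBody.vol {n : ℕ} (K : ConvexBody (EuclideanSpace ℝ (Fin n))) : ℝ :=
  volume.real (K : Set (EuclideanSpace ℝ (Fin n)))

/-- `|K | ξ^⊥|`: the volume, in the Euclidean space `ξ^⊥`, of the orthogonal projection of `K`
to `ξ^⊥`. -/
def ConvexBody.projVol {n : ℕ} (K : ConvexBody (EuclideanSpace ℝ (Fin n)))
    (ξ : EuclideanSpace ℝ (Fin n)) : ℝ :=
  volume.real ((Submodule.span ℝ {ξ})ᗮ.orthogonalProjectionOnto ''
    (K : Set (EuclideanSpace ℝ (Fin n))))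

/-- The support function `h_K(x) = max_{y ∈ K} ⟨x, y⟩`. -/
def ConvexBody.supportFn {n : ℕ} (K : ConvexBody (EuclideanSpace ℝ (Fin n)))
    (x : EuclideanSpace ℝ (Fin n)) : ℝ :=
  sSup ((fun y => inner ℝ x y) '' (K : Set (EuclideanSpace ℝ (Fin n))))

/-- `L` is the projection body of some convex body `M`: `h_L(θ) = |M | θ^⊥|` for every unit
vector `θ`. -/
def ConvexBody.IsProjectionBody {n : ℕ} (L : ConvexBody (EuclideanSpace ℝ (Fin n))) : Prop :=
  ∃ M : ConvexBody (EuclideanSpace ℝ (Fin n)), M.HasInterior ∧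
    ∀ θ : EuclideanSpace ℝ (Fin n), ‖θ‖ = 1 → L.supportFn θ = M.projVol θ

/-- The constant `c_n = |B_2^n|^{(n-1)/n} / |B_2^{n-1}|`, for `n ≥ 1`. -/
def sepConst (n : ℕ) : ℝ :=
  volume.real (Metric.closedBall (0 : EuclideanSpace ℝ (Fin n)) 1) ^ (((n : ℝ) - 1) / n) /
    volume.real (Metric.closedBall (0 : EuclideanSpace ℝ (Fin (n - 1))) 1)

end

/-! Suppose first that L is a zonotope Z, the sum of segments [-a_i, a_i]. Adding [-a, a] to a
convex C increases the volume by 2‖a‖ |C|a^⊥|, so W(C) = ∑ 2‖a_i‖ |C|a_i^⊥| is the first variation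
of |C + tZ| at t = 0, that is, n times a mixed volume. Brunn–Minkowski then gives n |C|^{(n-1)/n}
|Z|^{1/n} ≤ W(C) (`minkowski_first_inequality_zonotope`), while Z + tZ = (1 + t)Z gives W(Z) ≤ n |Z|
(`sum_projVolume_zonotope_le`).

Put A = ∑ 2‖a_i‖. The hypothesis in the directions a_i, weighted by 2‖a_i‖ and summed, reads W(K) ≤
W(Z) - εA. All projections of the unit ball have volume |B_2^{n-1}|, so Minkowski's inequality for
the ball says A ≥ n c_n |Z|^{1/n}. Hence n |K|^{(n-1)/n} |Z|^{1/n} ≤ n |Z| - n c_n ε |Z|^{1/n}; now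
divide by n |Z|^{1/n}.

A general projection body L is squeezed as (1 - η)L ⊆ Z ⊆ (1 + η)L, and η tends to 0
(`exists_zonotope_between`). For this, h_L(θ) = |M|θ^⊥| must be a uniform limit of sums ∑ |⟨θ,
a_i⟩|. In place of a surface area measure, take f = max(0, 1 - ‖x‖_M). On each line f rises to its
maximum and falls back to 0, so ∫ |∂_θ f| is twice the integral of these maxima over θ^⊥, which is a
constant times |M|θ^⊥|. Thus h_L(θ) = ∫ |⟨θ, G⟩| with G a multiple of ∇f
(`exists_integrable_projVolume_eq`), and L¹ approximation of G by simple functions gives the finite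
sums.

The balls of radius 1/2 and 1 give equality. -/

open scoped Pointwise ENNReal NNReal

/-! ### The Prékopa–Leindler inequality. -/

/-- The one-dimensional Brunn–Minkowski inequality for compact sets. -/
theorem Real.volume_add_volume_le_of_isCompact {A B C : Set ℝ} (hA : IsCompact A)
    (hB : IsCompact B) (hA0 : A.Nonempty) (hB0 : B.Nonempty) (h : A + B ⊆ C) :
    volume A + volume B ≤ volume C := by
  obtain ⟨a, haA, ha⟩ := hA.exists_isGreatest hA0
  obtain ⟨b, hbB, hb⟩ := hB.exists_isLeast hB0
  -- With a = max A and b = min B, the translates b + A and a + B both lie in A + B and meet at most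
  -- in the point a + b.
  have h1 : (b +ᵥ A) ∪ (a +ᵥ B) ⊆ C := by
    refine Set.Subset.trans ?_ h
    rintro x (⟨y, hy, rfl⟩ | ⟨y, hy, rfl⟩)
    · exact ⟨y, hy, b, hbB, add_comm _ _⟩
    · exact ⟨a, haA, y, hy, rfl⟩
  have h2 : (b +ᵥ A) ∩ (a +ᵥ B) ⊆ {a + b} := by
    rintro x ⟨⟨y, hy, rfl⟩, ⟨z, hz, hyz⟩⟩
    have h3 : y ≤ a := ha hy
    have h4 : b ≤ z := hb hz
    simp only [vadd_eq_add] at hyz ⊢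
    simp only [Set.mem_singleton_iff]
    linarith
  have h3 : volume ((b +ᵥ A) ∩ (a +ᵥ B)) = 0 :=
    measure_mono_null h2 (by simp)
  have hm : MeasurableSet (a +ᵥ B) := (hB.vadd a).measurableSet
  calc volume A + volume B = volume (b +ᵥ A) + volume (a +ᵥ B) := by simp
    _ = volume ((b +ᵥ A) ∪ (a +ᵥ B)) := by
        rw [← measure_union_add_inter _ hm, h3, add_zero]
    _ ≤ volume C := measure_mono h1

/-- Serves to pass from compact to measurable sets by inner regularity. Nonzero x and y have
something strictly below them, so the suprema are over nonempty families. -/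
theorem ENNReal.add_le_of_forall_lt' {x y z : ℝ≥0∞} (hx : x ≠ 0) (hy : y ≠ 0)
    (h : ∀ r < x, ∀ s < y, r + s ≤ z) : x + y ≤ z := by
  have h1 : ∀ r < x, r + y ≤ z := by
    intro r hr
    have : r + y = ⨆ s : Set.Iio y, (r + (s : ℝ≥0∞)) := by
      have : Nonempty (Set.Iio y) := ⟨⟨0, pos_iff_ne_zero.2 hy⟩⟩
      rw [← ENNReal.add_iSup, ← sSup_eq_iSup', isLUB_Iio.sSup_eq]
    rw [this]
    exact iSup_le fun s => h r hr s s.2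
  have : x + y = ⨆ s : Set.Iio x, ((s : ℝ≥0∞) + y) := by
    have : Nonempty (Set.Iio x) := ⟨⟨0, pos_iff_ne_zero.2 hx⟩⟩
    rw [← ENNReal.iSup_add, ← sSup_eq_iSup', isLUB_Iio.sSup_eq]
  rw [this]
  exact iSup_le fun s => h1 s s.2

/-- The one-dimensional Brunn–Minkowski inequality for measurable sets. -/
theorem Real.volume_add_volume_le {A B C : Set ℝ} (hA : MeasurableSet A)
    (hB : MeasurableSet B) (hA0 : A.Nonempty) (hB0 : B.Nonempty) (h : A + B ⊆ C) :
    volume A + volume B ≤ volume C := by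
  obtain ⟨a, ha⟩ := hA0
  obtain ⟨b, hb⟩ := hB0
  by_cases hA1 : volume A = 0
  · rw [hA1, zero_add, ← measure_vadd volume a B]
    refine measure_mono (Set.Subset.trans ?_ h)
    rintro x ⟨y, hy, rfl⟩
    exact ⟨a, ha, y, hy, rfl⟩
  by_cases hB1 : volume B = 0
  · rw [hB1, add_zero, ← measure_vadd volume b A]
    refine measure_mono (Set.Subset.trans ?_ h)
    rintro x ⟨y, hy, rfl⟩
    exact ⟨y, hy, b, hb, add_comm _ _⟩
  refine ENNReal.add_le_of_forall_lt' hA1 hB1 fun r hr s hs => ?_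
  obtain ⟨K, hKA, hK, hrK⟩ := hA.exists_lt_isCompact hr
  obtain ⟨L, hLB, hL, hsL⟩ := hB.exists_lt_isCompact hs
  have hK0 : K.Nonempty := nonempty_of_measure_ne_zero (ne_bot_of_gt hrK)
  have hL0 : L.Nonempty := nonempty_of_measure_ne_zero (ne_bot_of_gt hsL)
  exact (add_le_add hrK.le hsL.le).trans
    (Real.volume_add_volume_le_of_isCompact hK hL hK0 hL0
      ((Set.add_subset_add hKA hLB).trans h))

/-- The arithmetic form of the one-dimensional Prékopa–Leindler inequality, for functions with
values in `[0, 1]` and supremum `1`. -/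
theorem Real.prekopa_leindler_arith {a b : ℝ} (ha : 0 < a) (hb : 0 < b) (hab : a + b = 1)
    {f g h : ℝ → ℝ} (hf : Measurable f) (hg : Measurable g) (hh : Measurable h)
    (hf0 : ∀ x, 0 ≤ f x) (hg0 : ∀ x, 0 ≤ g x) (hh0 : ∀ x, 0 ≤ h x)
    (hf1 : ∀ x, f x ≤ 1) (hg1 : ∀ x, g x ≤ 1)
    (hfs : ∀ t < 1, ∃ x, t < f x) (hgs : ∀ t < 1, ∃ x, t < g x)
    (hfgh : ∀ x y, f x ^ a * g y ^ b ≤ h (a * x + b * y)) :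
    ENNReal.ofReal a * (∫⁻ x, ENNReal.ofReal (f x))
      + ENNReal.ofReal b * (∫⁻ x, ENNReal.ofReal (g x)) ≤ ∫⁻ x, ENNReal.ofReal (h x) := by
  rw [lintegral_eq_lintegral_meas_lt volume (.of_forall hf0) hf.aemeasurable,
    lintegral_eq_lintegral_meas_lt volume (.of_forall hg0) hg.aemeasurable,
    lintegral_eq_lintegral_meas_lt volume (.of_forall hh0) hh.aemeasurable,
    ← lintegral_const_mul' _ _ ENNReal.ofReal_ne_top,
    ← lintegral_const_mul' _ _ ENNReal.ofReal_ne_top]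
  have hanti : ∀ f : ℝ → ℝ, Measurable fun t : ℝ => volume {x | t < f x} := fun f =>
    (show Antitone fun t : ℝ => volume {x | t < f x} from fun s t hst =>
      measure_mono fun x hx => lt_of_le_of_lt hst hx).measurable
  rw [← lintegral_add_left ((hanti f).const_mul _)]
  refine setLIntegral_mono (hanti h) fun t ht => ?_
  -- Superlevel sets are compared at each height. Both suprema being 1, the two sets are nonempty
  -- for the same t < 1, as one-dimensional Brunn–Minkowski requires; for t ≥ 1 both are empty.
  rcases lt_or_ge t 1 with ht1 | ht1
  · have key := Real.volume_add_volume_le (A := a • {x | t < f x}) (B := b • {x | t < g x})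
      (C := {x | t < h x}) ((measurableSet_lt measurable_const hf).const_smul₀ a)
      ((measurableSet_lt measurable_const hg).const_smul₀ b)
      (Set.Nonempty.smul_set (hfs t ht1)) (Set.Nonempty.smul_set (hgs t ht1)) (by
        rintro z ⟨_, ⟨x, hx, rfl⟩, _, ⟨y, hy, rfl⟩, rfl⟩
        have ht0 : (0 : ℝ) < t := ht
        calc t = t ^ a * t ^ b := by rw [← Real.rpow_add ht0, hab, Real.rpow_one]
          _ < f x ^ a * g y ^ b := by
              apply mul_lt_mul'' (Real.rpow_lt_rpow ht0.le hx ha)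
                (Real.rpow_lt_rpow ht0.le hy hb) <;> positivity
          _ ≤ _ := hfgh x y)
    rw [Measure.addHaar_smul, Measure.addHaar_smul] at key
    simpa [abs_of_pos ha, abs_of_pos hb] using key
  · have e1 : {x | t < f x} = ∅ := by
      ext x; simpa using (hf1 x).trans ht1
    have e2 : {x | t < g x} = ∅ := by
      ext x; simpa using (hg1 x).trans ht1
    simp [e1, e2]

/-- Young's inequality with exponents 1/a and 1/b, applied to x^a and y^b. -/
theorem ENNReal.rpow_mul_rpow_le_arith {a b : ℝ} (ha : 0 < a) (hb : 0 < b) (hab : a + b = 1)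
    (x y : ℝ≥0∞) : x ^ a * y ^ b ≤ ENNReal.ofReal a * x + ENNReal.ofReal b * y := by
  have hpq : (a⁻¹).HolderConjugate b⁻¹ := by
    rw [Real.holderConjugate_iff]
    refine ⟨(one_lt_inv₀ ha).2 (by linarith), by simpa using hab⟩
  have := ENNReal.young_inequality (x ^ a) (y ^ b) hpq
  rwa [← ENNReal.rpow_mul, ← ENNReal.rpow_mul, mul_inv_cancel₀ ha.ne', mul_inv_cancel₀ hb.ne',
    ENNReal.rpow_one, ENNReal.rpow_one, ENNReal.ofReal_inv_of_pos ha,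
    ENNReal.ofReal_inv_of_pos hb, ENNReal.div_eq_inv_mul, ENNReal.div_eq_inv_mul,
    inv_inv, inv_inv] at this

/-- The one-dimensional Prékopa–Leindler inequality for bounded functions. -/
theorem Real.prekopa_leindler_of_bounded {a b : ℝ} (ha : 0 < a) (hb : 0 < b) (hab : a + b = 1)
    {f g h : ℝ → ℝ≥0∞} (hf : Measurable f) (hg : Measurable g) (hh : Measurable h)
    (hf1 : ⨆ x, f x ≠ ∞) (hg1 : ⨆ x, g x ≠ ∞)
    (hfgh : ∀ x y, f x ^ a * g y ^ b ≤ h (a * x + b * y)) :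
    (∫⁻ x, f x) ^ a * (∫⁻ x, g x) ^ b ≤ ∫⁻ x, h x := by
  set α := ⨆ x, f x with hα
  set β := ⨆ x, g x with hβ
  have hfα : ∀ x, f x ≤ α := le_iSup f
  have hgβ : ∀ x, g x ≤ β := le_iSup g
  by_cases hα0 : α = 0
  · have : ∀ x, f x = 0 := fun x => le_antisymm (hα0 ▸ hfα x) zero_le
    simp [this, ha]
  by_cases hβ0 : β = 0
  · have : ∀ x, g x = 0 := fun x => le_antisymm (hβ0 ▸ hgβ x) zero_le
    simp [this, hb]
  set γ := α ^ a * β ^ b with hγ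
  have hαa0 : α ^ a ≠ 0 := by simp [hα0, hf1]
  have hβb0 : β ^ b ≠ 0 := by simp [hβ0, hg1]
  have hαat : α ^ a ≠ ∞ := ENNReal.rpow_ne_top_of_nonneg ha.le hf1
  have hβbt : β ^ b ≠ ∞ := ENNReal.rpow_ne_top_of_nonneg hb.le hg1
  have hγ0 : γ ≠ 0 := mul_ne_zero hαa0 hβb0
  have hγt : γ ≠ ∞ := ENNReal.mul_ne_top hαat hβbt
  have hfq : ∀ x, f x / α ≤ 1 := fun x => ENNReal.div_le_of_le_mul (by simpa using hfα x)
  have hgq : ∀ x, g x / β ≤ 1 := fun x => ENNReal.div_le_of_le_mul (by simpa using hgβ x)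
  have hlt : ∀ {u : ℝ → ℝ≥0∞} {c : ℝ≥0∞}, c = ⨆ x, u x → c ≠ 0 → c ≠ ∞ → (∀ x, u x / c ≤ 1) →
      ∀ t < (1 : ℝ), ∃ x, t < (u x / c).toReal := by
    intro u c hc hc0 hct hq t ht
    by_contra! hcon
    have h1 : ∀ x, u x ≤ ENNReal.ofReal t * c := by
      intro x
      have := (ENNReal.le_ofReal_iff_toReal_le ((hq x).trans_lt ENNReal.one_lt_top).ne
        (ENNReal.toReal_nonneg.trans (hcon x))).2 (hcon x)
      exact (ENNReal.div_le_iff hc0 hct).1 this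
    have h2 : c ≤ ENNReal.ofReal t * c := by
      conv_lhs => rw [hc]
      exact iSup_le h1
    have h3 : ENNReal.ofReal t * c < 1 * c :=
      ENNReal.mul_lt_mul_left hc0 hct (by simpa using ht)
    rw [one_mul] at h3
    exact absurd h2 (not_le.2 h3)
  -- The quotient h/γ may be infinite; cutting it at 1 makes it real-valued and loses nothing, since
  -- the left side is at most 1.
  have hfgh' : ∀ x y, (f x / α).toReal ^ a * (g y / β).toReal ^ b
      ≤ (min (h (a * x + b * y) / γ) 1).toReal := by
    intro x y
    rw [ENNReal.toReal_rpow, ENNReal.toReal_rpow, ← ENNReal.toReal_mul]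
    refine ENNReal.toReal_mono (by simp) (le_min ?_ ?_)
    · rw [ENNReal.div_rpow_of_nonneg _ _ ha.le, ENNReal.div_rpow_of_nonneg _ _ hb.le, hγ,
        ← ENNReal.mul_div_mul_comm (Or.inl hαa0) (Or.inl hαat)]
      exact ENNReal.div_le_div_right (hfgh x y) _
    · exact mul_le_one' (ENNReal.rpow_le_one (hfq x) ha.le) (ENNReal.rpow_le_one (hgq y) hb.le)
  have key := Real.prekopa_leindler_arith ha hb hab
    (f := fun x => (f x / α).toReal) (g := fun x => (g x / β).toReal)
    (h := fun x => (min (h x / γ) 1).toReal)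
    (by fun_prop) (by fun_prop) (by fun_prop)
    (fun _ => ENNReal.toReal_nonneg) (fun _ => ENNReal.toReal_nonneg)
    (fun _ => ENNReal.toReal_nonneg)
    (fun x => ENNReal.toReal_le_of_le_ofReal zero_le_one (by simpa using hfq x))
    (fun x => ENNReal.toReal_le_of_le_ofReal zero_le_one (by simpa using hgq x))
    (hlt hα hα0 hf1 hfq) (hlt hβ hβ0 hg1 hgq) hfgh'
  have e1 : ∀ x, ENNReal.ofReal (f x / α).toReal = f x * α⁻¹ := fun x =>
    ENNReal.ofReal_toReal ((hfq x).trans_lt ENNReal.one_lt_top).ne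
  have e2 : ∀ x, ENNReal.ofReal (g x / β).toReal = g x * β⁻¹ := fun x =>
    ENNReal.ofReal_toReal ((hgq x).trans_lt ENNReal.one_lt_top).ne
  have e3 : ∀ x, ENNReal.ofReal (min (h x / γ) 1).toReal ≤ h x * γ⁻¹ := fun x =>
    ENNReal.ofReal_toReal_le.trans (min_le_left _ _)
  simp_rw [e1, e2] at key
  rw [lintegral_mul_const _ hf, lintegral_mul_const _ hg] at key
  have key2 := (ENNReal.rpow_mul_rpow_le_arith ha hb hab _ _).trans
    (key.trans (lintegral_mono e3))
  rw [lintegral_mul_const _ hh, ENNReal.mul_rpow_of_nonneg _ _ ha.le,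
    ENNReal.mul_rpow_of_nonneg _ _ hb.le, ENNReal.inv_rpow, ENNReal.inv_rpow,
    mul_mul_mul_comm, ← ENNReal.mul_inv (Or.inl hαa0) (Or.inl hαat)] at key2
  exact (ENNReal.mul_le_mul_iff_left (ENNReal.inv_ne_zero.2 hγt)
    (ENNReal.inv_ne_top.2 hγ0)).1 key2

/-- Monotone convergence for the truncations; a positive power is an order isomorphism of [0, ∞], so
it commutes with the supremum. -/
theorem MeasureTheory.lintegral_rpow_mul_le_of_forall_min {a : ℝ} (ha : 0 < a) {f : ℝ → ℝ≥0∞}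
    (hf : Measurable f) {c d : ℝ≥0∞}
    (h : ∀ N : ℕ, (∫⁻ x, min (f x) N) ^ a * c ≤ d) : (∫⁻ x, f x) ^ a * c ≤ d := by
  have e : ∀ x, f x = ⨆ N : ℕ, min (f x) N := by
    intro x
    rw [← inf_iSup_eq, ENNReal.iSup_natCast, inf_top_eq]
  have e2 : ∫⁻ x, f x = ⨆ N : ℕ, ∫⁻ x, min (f x) N := by
    rw [← lintegral_iSup (fun N => hf.min measurable_const)
      (fun M N hMN x => min_le_min_left _ (Nat.cast_le.2 hMN))]
    exact lintegral_congr e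
  rw [e2]
  have := (ENNReal.orderIsoRpow a ha).map_iSup (fun N : ℕ => ∫⁻ x, min (f x) N)
  simp only [ENNReal.orderIsoRpow_apply] at this
  rw [this, ENNReal.iSup_mul]
  exact iSup_le h

/-- The one-dimensional Prékopa–Leindler inequality. -/
theorem Real.prekopa_leindler {a b : ℝ} (ha : 0 < a) (hb : 0 < b) (hab : a + b = 1)
    {f g h : ℝ → ℝ≥0∞} (hf : Measurable f) (hg : Measurable g) (hh : Measurable h)
    (hfgh : ∀ x y, f x ^ a * g y ^ b ≤ h (a * x + b * y)) :
    (∫⁻ x, f x) ^ a * (∫⁻ x, g x) ^ b ≤ ∫⁻ x, h x := by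
  refine lintegral_rpow_mul_le_of_forall_min ha hf fun N => ?_
  rw [mul_comm]
  refine lintegral_rpow_mul_le_of_forall_min hb hg fun M => ?_
  rw [mul_comm]
  have hs : ∀ (u : ℝ → ℝ≥0∞) (N : ℕ), ⨆ x, min (u x) N ≠ ∞ := fun u N =>
    ne_top_of_le_ne_top (ENNReal.natCast_ne_top N) (iSup_le fun x => min_le_right _ _)
  refine Real.prekopa_leindler_of_bounded ha hb hab (by fun_prop) (by fun_prop) hh (hs f N)
    (hs g M) fun x y => le_trans ?_ (hfgh x y)
  gcongr <;> exact min_le_left _ _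

theorem MeasureTheory.lintegral_fin_succ {n : ℕ} {f : (Fin (n + 1) → ℝ) → ℝ≥0∞}
    (hf : Measurable f) :
    ∫⁻ x, f x = ∫⁻ s : ℝ, ∫⁻ z : Fin n → ℝ, f (Fin.cons s z) := by
  have mp := (volume_preserving_piFinSuccAbove (fun _ : Fin (n + 1) => ℝ) 0).symm
  rw [← mp.lintegral_comp hf, Measure.volume_eq_prod, lintegral_prod]
  · simp [MeasurableEquiv.piFinSuccAbove, Fin.consEquiv]
  · exact (hf.comp mp.measurable).aemeasurable

theorem measurable_fin_cons {n : ℕ} :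
    Measurable fun p : ℝ × (Fin n → ℝ) => (Fin.cons p.1 p.2 : Fin (n + 1) → ℝ) := by
  refine measurable_pi_lambda _ fun i => ?_
  refine Fin.cases ?_ (fun j => ?_) i
  · simpa using measurable_fst
  · simpa [Function.comp_def] using (measurable_pi_apply j).comp measurable_snd

/-- The Prékopa–Leindler inequality. -/
theorem prekopa_leindler {a b : ℝ} (ha : 0 < a) (hb : 0 < b) (hab : a + b = 1) {n : ℕ}
    {f g h : (Fin n → ℝ) → ℝ≥0∞} (hf : Measurable f) (hg : Measurable g) (hh : Measurable h)
    (hfgh : ∀ x y, f x ^ a * g y ^ b ≤ h (a • x + b • y)) :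
    (∫⁻ x, f x) ^ a * (∫⁻ x, g x) ^ b ≤ ∫⁻ x, h x := by
  induction n with
  | zero =>
    simp only [Measure.volume_pi_eq_dirac (0 : Fin 0 → ℝ), lintegral_dirac]
    simpa using hfgh 0 0
  | succ n ih =>
    have hm : ∀ {u : (Fin (n + 1) → ℝ) → ℝ≥0∞}, Measurable u →
        Measurable fun p : ℝ × (Fin n → ℝ) => u (Fin.cons p.1 p.2) := fun hu =>
      hu.comp measurable_fin_cons
    rw [lintegral_fin_succ hf, lintegral_fin_succ hg, lintegral_fin_succ hh]
    -- The one-dimensional inequality is applied to the integrals over slices; its hypothesis at s,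
    -- t is the induction hypothesis for the slices there.
    refine Real.prekopa_leindler ha hb hab (hm hf).lintegral_prod_right'
      (hm hg).lintegral_prod_right' (hm hh).lintegral_prod_right' fun s t => ?_
    refine ih ((hm hf).comp measurable_prodMk_left) ((hm hg).comp measurable_prodMk_left)
      ((hm hh).comp measurable_prodMk_left) fun x y => ?_
    convert hfgh (Fin.cons s x) (Fin.cons t y) using 2
    ext i
    refine Fin.cases ?_ (fun j => ?_) i <;> simp

/-! ### The Brunn–Minkowski inequality. -/

/-- The multiplicative Brunn–Minkowski inequality. -/
theorem EuclideanSpace.volume_rpow_mul_volume_rpow_le {n : ℕ} {a b : ℝ} (ha : 0 < a) (hb : 0 < b)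
    (hab : a + b = 1) {A B : Set (EuclideanSpace ℝ (Fin n))} (hA : IsCompact A)
    (hB : IsCompact B) : volume A ^ a * volume B ^ b ≤ volume (a • A + b • B) := by
  have hC : IsCompact (a • A + b • B) := (hA.smul a).add (hB.smul b)
  have mp := PiLp.volume_preserving_toLp (Fin n)
  have key := prekopa_leindler ha hb hab (n := n)
    (f := fun x => A.indicator 1 (WithLp.toLp 2 x))
    (g := fun x => B.indicator 1 (WithLp.toLp 2 x))
    (h := fun x => (a • A + b • B).indicator 1 (WithLp.toLp 2 x))
    ((measurable_one.indicator hA.measurableSet).comp mp.measurable)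
    ((measurable_one.indicator hB.measurableSet).comp mp.measurable)
    ((measurable_one.indicator hC.measurableSet).comp mp.measurable) (by
      intro x y
      by_cases hx : WithLp.toLp 2 x ∈ A
      · by_cases hy : WithLp.toLp 2 y ∈ B
        · have : a • WithLp.toLp 2 x + b • WithLp.toLp 2 y ∈ a • A + b • B :=
            ⟨_, ⟨_, hx, rfl⟩, _, ⟨_, hy, rfl⟩, rfl⟩
          simp [hx, hy, this]
        · simp [hy, hb]
      · simp [hx, ha])
  rw [mp.lintegral_comp (measurable_one.indicator hA.measurableSet),
    mp.lintegral_comp (measurable_one.indicator hB.measurableSet),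
    mp.lintegral_comp (measurable_one.indicator hC.measurableSet),
    lintegral_indicator_one hA.measurableSet, lintegral_indicator_one hB.measurableSet,
    lintegral_indicator_one hC.measurableSet] at key
  exact key

theorem EuclideanSpace.volume_real_smul {n : ℕ} {c : ℝ} (hc : 0 ≤ c)
    (A : Set (EuclideanSpace ℝ (Fin n))) :
    volume.real (c • A) = c ^ n * volume.real A := by
  rw [measureReal_def, Measure.addHaar_smul, ENNReal.toReal_mul, measureReal_def,
    ENNReal.toReal_ofReal (abs_nonneg _), finrank_euclideanSpace_fin, abs_of_nonneg (by positivity)]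

/-- The Brunn–Minkowski inequality for compact sets. -/
theorem EuclideanSpace.brunn_minkowski {n : ℕ} (hn : n ≠ 0)
    {A B : Set (EuclideanSpace ℝ (Fin n))} (hA : IsCompact A) (hB : IsCompact B)
    (hA0 : A.Nonempty) (hB0 : B.Nonempty) :
    (volume.real A ^ (n : ℝ)⁻¹ + volume.real B ^ (n : ℝ)⁻¹) ^ n ≤ volume.real (A + B) := by
  have hC : IsCompact (A + B) := hA.add hB
  have hn' : (n : ℝ)⁻¹ ≠ 0 := by simpa using hn
  set p := volume.real A ^ (n : ℝ)⁻¹ with hp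
  set q := volume.real B ^ (n : ℝ)⁻¹ with hq
  have hpn : p ^ n = volume.real A := Real.rpow_inv_natCast_pow measureReal_nonneg hn
  have hqn : q ^ n = volume.real B := Real.rpow_inv_natCast_pow measureReal_nonneg hn
  have hp0 : 0 ≤ p := Real.rpow_nonneg measureReal_nonneg _
  have hq0 : 0 ≤ q := Real.rpow_nonneg measureReal_nonneg _
  obtain ⟨x, hx⟩ := hA0
  obtain ⟨y, hy⟩ := hB0
  rcases hp0.eq_or_lt with hp1 | hp1
  · rw [← hp1, zero_add, hqn, measureReal_def, measureReal_def, ← measure_vadd volume x B]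
    refine ENNReal.toReal_mono hC.measure_lt_top.ne (measure_mono ?_)
    rintro _ ⟨z, hz, rfl⟩
    exact ⟨x, hx, z, hz, rfl⟩
  rcases hq0.eq_or_lt with hq1 | hq1
  · rw [← hq1, add_zero, hpn, measureReal_def, measureReal_def, ← measure_vadd volume y A]
    refine ENNReal.toReal_mono hC.measure_lt_top.ne (measure_mono ?_)
    rintro _ ⟨z, hz, rfl⟩
    exact ⟨z, hz, y, hy, add_comm _ _⟩
  have hs : 0 < p + q := by positivity
  -- Both p⁻¹A and q⁻¹B have volume 1, and these weights turn their combination into (p + q)⁻¹(A +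
  -- B).
  have key := EuclideanSpace.volume_rpow_mul_volume_rpow_le (a := p / (p + q)) (b := q / (p + q))
    (by positivity) (by positivity) (by field_simp) (hA.smul p⁻¹) (hB.smul q⁻¹)
  rw [smul_smul, smul_smul] at key
  have e1 : p / (p + q) * p⁻¹ = (p + q)⁻¹ := by field_simp
  have e2 : q / (p + q) * q⁻¹ = (p + q)⁻¹ := by field_simp
  rw [e1, e2, ← smul_add] at key
  have key2 := ENNReal.toReal_mono ((hC.smul (p + q)⁻¹).measure_lt_top.ne) key
  rw [ENNReal.toReal_mul, ← ENNReal.toReal_rpow, ← ENNReal.toReal_rpow, ← measureReal_def,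
    ← measureReal_def, ← measureReal_def, EuclideanSpace.volume_real_smul (by positivity),
    EuclideanSpace.volume_real_smul (by positivity),
    EuclideanSpace.volume_real_smul (by positivity), ← hpn, ← hqn, ← mul_pow, ← mul_pow,
    inv_mul_cancel₀ hp1.ne', inv_mul_cancel₀ hq1.ne', one_pow, Real.one_rpow, Real.one_rpow,
    inv_pow, one_mul] at key2
  rwa [inv_mul_eq_div, one_le_div (by positivity)] at key2

/-! ### Projections, fibres and sums with segments. -/

/-- The volume of the orthogonal projection of the set `A` to the hyperplane `u^⊥`. -/
noncomputable def projVolume {n : ℕ} (A : Set (EuclideanSpace ℝ (Fin n)))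
    (u : EuclideanSpace ℝ (Fin n)) : ℝ :=
  volume.real ((Submodule.span ℝ {u})ᗮ.orthogonalProjectionOnto '' A)

section Fubini

variable {n : ℕ} {u : EuclideanSpace ℝ (Fin n)}

theorem measurePreserving_add_smul (hu : ‖u‖ = 1) :
    MeasurePreserving (fun p : (Submodule.span ℝ {u})ᗮ × ℝ =>
      (p.1 : EuclideanSpace ℝ (Fin n)) + p.2 • u) := by
  have h1 : MeasurePreserving (Prod.swap : (Submodule.span ℝ {u})ᗮ × ℝ → _) :=
    Measure.measurePreserving_swap
  have h2 : MeasurePreserving (Prod.map (LinearIsometryEquiv.toSpanUnitSingleton (𝕜 := ℝ) u hu)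
      (id : (Submodule.span ℝ {u})ᗮ → _)) :=
    (LinearIsometryEquiv.measurePreserving _).prod (MeasurePreserving.id _)
  have h3 := WithLp.volume_preserving_toLp (Submodule.span ℝ {u}) (Submodule.span ℝ {u})ᗮ
  have h4 := (Submodule.span ℝ {u}).orthogonalDecomposition.symm.measurePreserving
  convert h4.comp (h3.comp (h2.comp h1)) using 1
  ext1 p
  simp [add_comm]

theorem lintegral_eq_lintegral_orthogonal (hu : ‖u‖ = 1)
    {F : EuclideanSpace ℝ (Fin n) → ℝ≥0∞} (hF : Measurable F) :
    ∫⁻ x, F x = ∫⁻ y : (Submodule.span ℝ {u})ᗮ, ∫⁻ t : ℝ, F (y + t • u) := by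
  have mp := measurePreserving_add_smul hu
  rw [← mp.lintegral_comp hF, Measure.volume_eq_prod, lintegral_prod]
  exact (hF.comp mp.measurable).aemeasurable

theorem volume_eq_lintegral_fiber (hu : ‖u‖ = 1) {A : Set (EuclideanSpace ℝ (Fin n))}
    (hA : MeasurableSet A) :
    volume A = ∫⁻ y : (Submodule.span ℝ {u})ᗮ,
      volume {t : ℝ | (y : EuclideanSpace ℝ (Fin n)) + t • u ∈ A} := by
  have mp := measurePreserving_add_smul hu
  rw [← lintegral_indicator_one hA,
    lintegral_eq_lintegral_orthogonal hu (measurable_one.indicator hA)]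
  refine lintegral_congr fun y => ?_
  have hm : MeasurableSet {t : ℝ | (y : EuclideanSpace ℝ (Fin n)) + t • u ∈ A} :=
    (mp.measurable.comp measurable_prodMk_left) hA
  rw [← lintegral_indicator_one hm]
  rfl

theorem orthogonalProjectionOnto_add_smul (y : (Submodule.span ℝ {u})ᗮ) (t : ℝ) :
    (Submodule.span ℝ {u})ᗮ.orthogonalProjectionOnto
      ((y : EuclideanSpace ℝ (Fin n)) + t • u) = y := by
  rw [map_add, Submodule.orthogonalProjectionOnto_mem_subspace_eq_self,
    Submodule.orthogonalProjectionOnto_apply_of_mem_orthogonal, add_zero]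
  exact Submodule.le_orthogonal_orthogonal _
    (Submodule.smul_mem _ _ (Submodule.mem_span_singleton_self u))

theorem exists_eq_orthogonalProjectionOnto_add_smul (x : EuclideanSpace ℝ (Fin n)) :
    ∃ t : ℝ, x = ((Submodule.span ℝ {u})ᗮ.orthogonalProjectionOnto x :
      EuclideanSpace ℝ (Fin n)) + t • u := by
  have h := (Submodule.span ℝ {u}).starProjection_add_starProjection_orthogonal x
  have h2 : (Submodule.span ℝ {u}).starProjection x ∈ Submodule.span ℝ {u} :=
    Submodule.starProjection_apply_mem _ _
  obtain ⟨t, ht⟩ := Submodule.mem_span_singleton.1 h2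
  exact ⟨t, by rw [ht, add_comm]; exact h.symm⟩

theorem mem_orthogonalProjectionOnto_image_iff {A : Set (EuclideanSpace ℝ (Fin n))}
    {y : (Submodule.span ℝ {u})ᗮ} :
    y ∈ (Submodule.span ℝ {u})ᗮ.orthogonalProjectionOnto '' A ↔
      ∃ t : ℝ, (y : EuclideanSpace ℝ (Fin n)) + t • u ∈ A := by
  constructor
  · rintro ⟨x, hx, rfl⟩
    obtain ⟨t, ht⟩ := exists_eq_orthogonalProjectionOnto_add_smul (u := u) x
    exact ⟨t, ht ▸ hx⟩
  · rintro ⟨t, ht⟩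
    exact ⟨_, ht, orthogonalProjectionOnto_add_smul y t⟩

end Fubini

theorem Real.volume_add_Icc {S : Set ℝ} (hS : IsCompact S) (hc : Convex ℝ S) (hne : S.Nonempty)
    {s : ℝ} (hs : 0 ≤ s) :
    volume (S + Set.Icc (-s) s) = volume S + ENNReal.ofReal (2 * s) := by
  have hconn : IsConnected S := ⟨hne, hc.isPreconnected⟩
  have hle : sInf S ≤ sSup S := csInf_le_csSup hne hS.bddBelow hS.bddAbove
  rw [eq_Icc_of_connected_compact hconn hS, Set.Icc_add_Icc hle (by linarith), Real.volume_Icc,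
    Real.volume_Icc, ← ENNReal.ofReal_add (by linarith) (by linarith)]
  congr 1
  ring

/-- Adding the segment `[-s u, s u]` to a compact convex set. -/
theorem volume_add_segment_of_norm_eq_one {n : ℕ} {C : Set (EuclideanSpace ℝ (Fin n))}
    (hC : IsCompact C) (hc : Convex ℝ C) {u : EuclideanSpace ℝ (Fin n)} (hu : ‖u‖ = 1)
    {s : ℝ} (hs : 0 ≤ s) :
    volume (C + segment ℝ (-(s • u)) (s • u)) = volume C + ENNReal.ofReal (2 * s) *
      volume ((Submodule.span ℝ {u})ᗮ.orthogonalProjectionOnto '' C) := by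
  have hseg : segment ℝ (-(s • u)) (s • u) = (fun t : ℝ => t • u) '' Set.Icc (-s) s := by
    rw [← neg_smul, ← segment_eq_Icc (by linarith : -s ≤ s)]
    exact (image_segment ℝ (LinearMap.toSpanSingleton ℝ _ u).toAffineMap (-s) s).symm
  have hsegc : IsCompact (segment ℝ (-(s • u)) (s • u)) := by
    rw [hseg]
    exact isCompact_Icc.image (by fun_prop)
  have hPc : IsCompact ((Submodule.span ℝ {u})ᗮ.orthogonalProjectionOnto '' C) :=
    hC.image (ContinuousLinearMap.continuous _)
  have hfib : ∀ y : (Submodule.span ℝ {u})ᗮ,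
      {t : ℝ | (y : EuclideanSpace ℝ (Fin n)) + t • u ∈ C + segment ℝ (-(s • u)) (s • u)} =
      {t : ℝ | (y : EuclideanSpace ℝ (Fin n)) + t • u ∈ C} + Set.Icc (-s) s := by
    intro y
    ext t
    rw [hseg]
    constructor
    · rintro ⟨c, hcC, _, ⟨r, hr, rfl⟩, h⟩
      refine ⟨t - r, ?_, r, hr, by simp⟩
      have : c = y + (t - r) • u := by
        rw [sub_smul, ← add_sub_assoc, ← h]; simp
      simpa [← this] using hcC
    · rintro ⟨t', ht', r, hr, rfl⟩
      exact ⟨_, ht', _, ⟨r, hr, rfl⟩, by simp [add_smul, add_assoc]⟩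
  rw [volume_eq_lintegral_fiber hu (hC.add hsegc).measurableSet,
    volume_eq_lintegral_fiber hu hC.measurableSet, ← lintegral_indicator_const hPc.measurableSet,
    ← lintegral_add_right _ (measurable_const.indicator hPc.measurableSet)]
  -- Over the projection of C the fibre is a nonempty interval and gains length 2s; elsewhere it is
  -- empty and stays so.
  refine lintegral_congr fun y => ?_
  rw [hfib y]
  by_cases hy : y ∈ (Submodule.span ℝ {u})ᗮ.orthogonalProjectionOnto '' C
  · rw [Set.indicator_of_mem hy]
    have hemb : Topology.IsClosedEmbedding
        fun t : ℝ => (y : EuclideanSpace ℝ (Fin n)) + t • u := by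
      refine Isometry.isClosedEmbedding (Isometry.of_dist_eq fun a b => ?_)
      rw [dist_add_left, dist_eq_norm, ← sub_smul, norm_smul, hu, mul_one, dist_eq_norm]
    refine Real.volume_add_Icc (hemb.isCompact_preimage hC) ?_
      (mem_orthogonalProjectionOnto_image_iff.1 hy) hs
    intro a ha b hb p q hp hq hpq
    have := hc ha hb hp hq hpq
    have hy' : (y : EuclideanSpace ℝ (Fin n)) = (p + q) • (y : EuclideanSpace ℝ (Fin n)) := by
      rw [hpq, one_smul]
    have e : (y : EuclideanSpace ℝ (Fin n)) + (p • a + q • b) • u =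
        p • ((y : EuclideanSpace ℝ (Fin n)) + a • u) + q • (y + b • u) := by
      conv_lhs => rw [hy']
      simp only [smul_eq_mul]
      module
    exact (congrArg (· ∈ C) e).mpr this
  · rw [Set.indicator_of_notMem hy, add_zero]
    have : {t : ℝ | (y : EuclideanSpace ℝ (Fin n)) + t • u ∈ C} = ∅ := by
      rw [Set.eq_empty_iff_forall_notMem]
      exact fun t ht => hy (mem_orthogonalProjectionOnto_image_iff.2 ⟨t, ht⟩)
    simp [this]

theorem projVolume_smul_right {n : ℕ} (A : Set (EuclideanSpace ℝ (Fin n)))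
    (u : EuclideanSpace ℝ (Fin n)) {c : ℝ} (hc : c ≠ 0) :
    projVolume A (c • u) = projVolume A u := by
  have : Submodule.span ℝ {c • u} = Submodule.span ℝ {u} :=
    Submodule.span_singleton_smul_eq (IsUnit.mk0 c hc) u
  have key : ∀ S T : Submodule ℝ (EuclideanSpace ℝ (Fin n)), S = T →
      volume.real (Sᗮ.orthogonalProjectionOnto '' A) =
        volume.real (Tᗮ.orthogonalProjectionOnto '' A) := by
    rintro S _ rfl
    rfl
  exact key _ _ this

theorem projVolume_nonneg {n : ℕ} (A : Set (EuclideanSpace ℝ (Fin n)))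
    (u : EuclideanSpace ℝ (Fin n)) : 0 ≤ projVolume A u := measureReal_nonneg

theorem projVolume_mono {n : ℕ} {A B : Set (EuclideanSpace ℝ (Fin n))} (hAB : A ⊆ B)
    (hB : IsCompact B) (u : EuclideanSpace ℝ (Fin n)) : projVolume A u ≤ projVolume B u :=
  measureReal_mono (Set.image_mono hAB)
    (hB.image (ContinuousLinearMap.continuous _)).measure_lt_top.ne

theorem projVolume_smul {n : ℕ} (A : Set (EuclideanSpace ℝ (Fin n)))
    {u : EuclideanSpace ℝ (Fin n)} (hu : u ≠ 0) {c : ℝ} (hc : 0 ≤ c) :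
    projVolume (c • A) u = c ^ (n - 1) * projVolume A u := by
  have hfr : Module.finrank ℝ (Submodule.span ℝ {u})ᗮ = n - 1 := by
    have h1 := (Submodule.span ℝ {u}).finrank_add_finrank_orthogonal
    rw [finrank_span_singleton hu, finrank_euclideanSpace_fin] at h1
    omega
  unfold projVolume
  rw [image_smul_set, measureReal_def, Measure.addHaar_smul, ENNReal.toReal_mul,
    ENNReal.toReal_ofReal (abs_nonneg _), hfr, abs_of_nonneg (by positivity), measureReal_def]

theorem projVolume_vadd {n : ℕ} (A : Set (EuclideanSpace ℝ (Fin n)))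
    (u v : EuclideanSpace ℝ (Fin n)) : projVolume (v +ᵥ A) u = projVolume A u := by
  unfold projVolume
  have : (Submodule.span ℝ {u})ᗮ.orthogonalProjectionOnto '' (v +ᵥ A) =
      (Submodule.span ℝ {u})ᗮ.orthogonalProjectionOnto v +ᵥ
        ((Submodule.span ℝ {u})ᗮ.orthogonalProjectionOnto '' A) := by
    ext y
    simp [Set.mem_vadd_set]
  rw [this, measureReal_def, measure_vadd, measureReal_def]

/-- Adding a symmetric segment to a compact convex set. -/
theorem volume_real_add_segment {n : ℕ} {C : Set (EuclideanSpace ℝ (Fin n))}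
    (hC : IsCompact C) (hc : Convex ℝ C) (a : EuclideanSpace ℝ (Fin n)) :
    volume.real (C + segment ℝ (-a) a) = volume.real C + 2 * ‖a‖ * projVolume C a := by
  rcases eq_or_ne a 0 with rfl | ha
  · simp
  have hna : ‖a‖ ≠ 0 := norm_ne_zero_iff.2 ha
  have hu : ‖‖a‖⁻¹ • a‖ = 1 := by rw [norm_smul, norm_inv, norm_norm, inv_mul_cancel₀ hna]
  have h := volume_add_segment_of_norm_eq_one hC hc hu (norm_nonneg a)
  rw [smul_smul, mul_inv_cancel₀ hna, one_smul] at h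
  have hPc : IsCompact ((Submodule.span ℝ {‖a‖⁻¹ • a})ᗮ.orthogonalProjectionOnto '' C) :=
    hC.image (ContinuousLinearMap.continuous _)
  rw [← projVolume_smul_right C a (inv_ne_zero hna), measureReal_def, h, ENNReal.toReal_add
    hC.measure_lt_top.ne (ENNReal.mul_ne_top ENNReal.ofReal_ne_top hPc.measure_lt_top.ne),
    ENNReal.toReal_mul, ENNReal.toReal_ofReal (by positivity)]
  rfl

/-! ### Zonotopes. -/

/-- The zonotope `∑ i ∈ s, [-a i, a i]`. -/
def zonotope {ι : Type*} {n : ℕ} (s : Finset ι) (a : ι → EuclideanSpace ℝ (Fin n)) :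
    Set (EuclideanSpace ℝ (Fin n)) :=
  ∑ i ∈ s, segment ℝ (-a i) (a i)

section Zonotope

variable {ι : Type*} {n : ℕ}

theorem isCompact_segment {E : Type*} [NormedAddCommGroup E] [NormedSpace ℝ E] (x y : E) :
    IsCompact (segment ℝ x y) := by
  rw [← convexHull_pair]
  exact (Set.toFinite _).isCompact_convexHull ℝ

theorem zero_mem_segment_neg (a : EuclideanSpace ℝ (Fin n)) : 0 ∈ segment ℝ (-a) a :=
  ⟨1 / 2, 1 / 2, by norm_num, by norm_num, by norm_num, by simp⟩

theorem zonotope_insert [DecidableEq ι] {s : Finset ι} {i : ι} (hi : i ∉ s)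
    (a : ι → EuclideanSpace ℝ (Fin n)) :
    zonotope (insert i s) a = zonotope s a + segment ℝ (-a i) (a i) := by
  rw [zonotope, Finset.sum_insert hi, add_comm, zonotope]

theorem isCompact_zonotope (s : Finset ι) (a : ι → EuclideanSpace ℝ (Fin n)) :
    IsCompact (zonotope s a) := by
  classical
  induction s using Finset.induction_on with
  | empty => simp [zonotope]
  | insert i s hi ih =>
    rw [zonotope_insert hi]
    exact ih.add (isCompact_segment _ _)

theorem convex_zonotope (s : Finset ι) (a : ι → EuclideanSpace ℝ (Fin n)) :
    Convex ℝ (zonotope s a) :=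
  convex_sum _ fun _ _ => convex_segment _ _

theorem zero_mem_zonotope (s : Finset ι) (a : ι → EuclideanSpace ℝ (Fin n)) :
    0 ∈ zonotope s a := by
  classical
  induction s using Finset.induction_on with
  | empty => simp [zonotope]
  | insert i s hi ih =>
    rw [zonotope_insert hi]
    exact ⟨0, ih, 0, zero_mem_segment_neg _, add_zero 0⟩

theorem smul_zonotope (s : Finset ι) (a : ι → EuclideanSpace ℝ (Fin n)) (c : ℝ) :
    c • zonotope s a = zonotope s (fun i => c • a i) := by
  classical
  induction s using Finset.induction_on with
  | empty => simp [zonotope]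
  | insert i s hi ih =>
    rw [zonotope_insert hi, zonotope_insert hi, smul_add, ih, ← smul_neg]
    congr 1
    exact image_segment ℝ (c • LinearMap.id : EuclideanSpace ℝ (Fin n) →ₗ[ℝ] _).toAffineMap _ _

theorem inner_le_of_mem_zonotope {s : Finset ι} {a : ι → EuclideanSpace ℝ (Fin n)}
    {x : EuclideanSpace ℝ (Fin n)} (hx : x ∈ zonotope s a) (θ : EuclideanSpace ℝ (Fin n)) :
    inner ℝ θ x ≤ ∑ i ∈ s, |inner ℝ θ (a i)| := by
  classical
  induction s using Finset.induction_on generalizing x with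
  | empty =>
    have : x = 0 := by simpa [zonotope] using hx
    simp [this]
  | insert i s hi ih =>
    rw [zonotope_insert hi] at hx
    obtain ⟨y, hy, z, ⟨p, q, hp, hq, hpq, rfl⟩, rfl⟩ := hx
    rw [Finset.sum_insert hi, inner_add_right, add_comm]
    refine add_le_add ?_ (ih hy)
    simp only [inner_add_right, inner_smul_right, inner_neg_right]
    have h1 := le_abs_self (inner ℝ θ (a i))
    have h2 := neg_abs_le (inner ℝ θ (a i))
    have hq' : q = 1 - p := by linarith
    subst hq'
    nlinarith

theorem exists_mem_zonotope_inner_eq (s : Finset ι) (a : ι → EuclideanSpace ℝ (Fin n))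
    (θ : EuclideanSpace ℝ (Fin n)) :
    ∃ x ∈ zonotope s a, inner ℝ θ x = ∑ i ∈ s, |inner ℝ θ (a i)| := by
  classical
  induction s using Finset.induction_on with
  | empty => exact ⟨0, by simp [zonotope], by simp⟩
  | insert i s hi ih =>
    obtain ⟨x, hx, hxe⟩ := ih
    rw [zonotope_insert hi, Finset.sum_insert hi]
    rcases le_total 0 (inner ℝ θ (a i)) with h | h
    · exact ⟨x + a i, ⟨x, hx, _, right_mem_segment _ _ _, rfl⟩, by
        rw [inner_add_right, hxe, abs_of_nonneg h, add_comm]⟩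
    · exact ⟨x + -a i, ⟨x, hx, _, left_mem_segment _ _ _, rfl⟩, by
        rw [inner_add_right, hxe, abs_of_nonpos h, add_comm, inner_neg_right]⟩

/-- Adding the segments one at a time, each contributes the projection of a partial sum, which lies
inside that of the whole sum. The next bound is the same argument with the projection of C from
below. -/
theorem volume_add_zonotope_le {C : Set (EuclideanSpace ℝ (Fin n))} (hC : IsCompact C)
    (hc : Convex ℝ C) (s : Finset ι) (a : ι → EuclideanSpace ℝ (Fin n)) :
    volume.real (C + zonotope s a) ≤
      volume.real C + ∑ i ∈ s, 2 * ‖a i‖ * projVolume (C + zonotope s a) (a i) := by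
  classical
  induction s using Finset.induction_on with
  | empty => simp [zonotope]
  | insert i s hi ih =>
    have hcomp := hC.add (isCompact_zonotope s a)
    have hsub : C + zonotope s a ⊆ C + zonotope (insert i s) a := by
      rw [zonotope_insert hi, ← add_assoc]
      exact fun x hx => ⟨x, hx, 0, zero_mem_segment_neg _, add_zero x⟩
    have hmono := fun j => projVolume_mono hsub (hC.add (isCompact_zonotope (insert i s) a)) (a j)
    rw [Finset.sum_insert hi]
    conv_lhs => rw [zonotope_insert hi, ← add_assoc,
      volume_real_add_segment hcomp (hc.add (convex_zonotope s a))]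
    have h1 : ∑ j ∈ s, 2 * ‖a j‖ * projVolume (C + zonotope s a) (a j) ≤
        ∑ j ∈ s, 2 * ‖a j‖ * projVolume (C + zonotope (insert i s) a) (a j) :=
      Finset.sum_le_sum fun j _ => mul_le_mul_of_nonneg_left (hmono j) (by positivity)
    have h2 := mul_le_mul_of_nonneg_left (hmono i) (by positivity : 0 ≤ 2 * ‖a i‖)
    linarith

theorem le_volume_add_zonotope {C : Set (EuclideanSpace ℝ (Fin n))} (hC : IsCompact C)
    (hc : Convex ℝ C) (s : Finset ι) (a : ι → EuclideanSpace ℝ (Fin n)) :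
    volume.real C + ∑ i ∈ s, 2 * ‖a i‖ * projVolume C (a i) ≤
      volume.real (C + zonotope s a) := by
  classical
  induction s using Finset.induction_on with
  | empty => simp [zonotope]
  | insert i s hi ih =>
    have hcomp := hC.add (isCompact_zonotope s a)
    have hsub : C ⊆ C + zonotope s a := fun x hx => ⟨x, hx, 0, zero_mem_zonotope s a, add_zero x⟩
    rw [Finset.sum_insert hi, zonotope_insert hi, ← add_assoc C,
      volume_real_add_segment hcomp (hc.add (convex_zonotope s a))]
    have h2 := mul_le_mul_of_nonneg_left (projVolume_mono hsub hcomp (a i))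
      (by positivity : 0 ≤ 2 * ‖a i‖)
    linarith

end Zonotope

/-! ### Minkowski's first inequality for zonotopes. -/

theorem pow_add_mul_pow_mul_le {p x : ℝ} (hp : 0 ≤ p) (hx : 0 ≤ x) (n : ℕ) :
    p ^ n + n * p ^ (n - 1) * x ≤ (p + x) ^ n := by
  cases n with
  | zero => simp
  | succ m =>
    induction m with
    | zero => simp
    | succ m ih =>
      have h := mul_le_mul_of_nonneg_right ih (by positivity : 0 ≤ p + x)
      rw [← pow_succ] at h
      refine le_trans ?_ h
      simp only [Nat.add_sub_cancel]
      push_cast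
      have : 0 ≤ (m + 1) * p ^ m * x * x := by positivity
      ring_nf at this ⊢
      linarith

theorem one_add_pow_le {t : ℝ} (ht : 0 ≤ t) (n : ℕ) :
    (1 + t) ^ n ≤ 1 + n * t * (1 + t) ^ (n - 1) := by
  cases n with
  | zero => simp
  | succ m =>
    induction m with
    | zero => simp
    | succ m ih =>
      have h := mul_le_mul_of_nonneg_right ih (by positivity : 0 ≤ 1 + t)
      rw [← pow_succ] at h
      refine h.trans ?_
      simp only [Nat.add_sub_cancel]
      push_cast
      have h1 : 1 ≤ (1 + t) ^ (m + 1) := one_le_pow₀ (by linarith)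
      have h2 := mul_le_mul_of_nonneg_left h1 ht
      have h3 : (1 + (m + 1) * t * (1 + t) ^ m) * (1 + t)
        = 1 + t + (m + 1) * t * (1 + t) ^ (m + 1) := by ring
      rw [h3]
      linarith

/-- Letting t decrease to 0 here replaces differentiating a volume at t = 0. -/
theorem le_of_forall_pos_le_one_add_mul_pow_mul {x y c : ℝ} (m : ℕ)
    (h : ∀ t : ℝ, 0 < t → x ≤ (1 + c * t) ^ m * y) : x ≤ y := by
  have h1 : Filter.Tendsto (fun t : ℝ => (1 + c * t) ^ m * y) (nhdsWithin 0 (Set.Ioi 0))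
      (nhds y) := by
    have : ContinuousAt (fun t : ℝ => (1 + c * t) ^ m * y) 0 := by fun_prop
    simpa using this.tendsto.mono_left nhdsWithin_le_nhds
  exact ge_of_tendsto h1 (eventually_nhdsWithin_of_forall h)

section Minkowski

variable {ι : Type*} {n : ℕ}

theorem exists_subset_smul_of_zero_mem_interior {K Z : Set (EuclideanSpace ℝ (Fin n))}
    (hK0 : 0 ∈ interior K) (hZ : IsCompact Z) : ∃ c : ℝ, 0 < c ∧ Z ⊆ c • K := by
  obtain ⟨r, hr, hrK⟩ := Metric.isOpen_iff.1 isOpen_interior 0 hK0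
  obtain ⟨R, hR, hRZ⟩ := hZ.isBounded.exists_pos_norm_le
  refine ⟨2 * R / r, by positivity, fun x hx => ?_⟩
  rw [Set.mem_smul_set_iff_inv_smul_mem₀ (by positivity)]
  refine interior_subset (hrK ?_)
  rw [mem_ball_zero_iff, norm_smul, Real.norm_of_nonneg (by positivity), inv_div, div_mul_eq_mul_div,
    div_lt_iff₀ (by positivity)]
  have := hRZ x hx
  nlinarith

/-- Minkowski's first inequality for a convex body and a zonotope: the right side is `n` times
the mixed volume. -/
theorem minkowski_first_inequality_zonotope (hn : n ≠ 0) {K : Set (EuclideanSpace ℝ (Fin n))}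
    (hK : IsCompact K) (hc : Convex ℝ K) (hK0 : 0 ∈ interior K) (s : Finset ι)
    {a : ι → EuclideanSpace ℝ (Fin n)} (ha : ∀ i ∈ s, a i ≠ 0) :
    n * (volume.real K ^ (n : ℝ)⁻¹) ^ (n - 1) * volume.real (zonotope s a) ^ (n : ℝ)⁻¹ ≤
      ∑ i ∈ s, 2 * ‖a i‖ * projVolume K (a i) := by
  obtain ⟨c, hc0, hcZ⟩ := exists_subset_smul_of_zero_mem_interior hK0 (isCompact_zonotope s a)
  set p := volume.real K ^ (n : ℝ)⁻¹ with hp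
  set q := volume.real (zonotope s a) ^ (n : ℝ)⁻¹ with hq
  have hpn : p ^ n = volume.real K := Real.rpow_inv_natCast_pow measureReal_nonneg hn
  have hqn : q ^ n = volume.real (zonotope s a) :=
    Real.rpow_inv_natCast_pow measureReal_nonneg hn
  have hp0 : 0 ≤ p := Real.rpow_nonneg measureReal_nonneg _
  have hq0 : 0 ≤ q := Real.rpow_nonneg measureReal_nonneg _
  have hKne : K.Nonempty := ⟨0, interior_subset hK0⟩
  refine le_of_forall_pos_le_one_add_mul_pow_mul (c := c) (n - 1) fun t ht => ?_
  -- The upper bound for |K + tZ| involves projections of K + tZ itself; this inclusion bounds them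
  -- by those of K, up to a factor (1 + ct)^(n-1) that tends to 1.
  have hsub : K + t • zonotope s a ⊆ (1 + c * t) • K := by
    rw [hc.add_smul (by positivity) (by positivity), one_smul, mul_comm, mul_smul]
    exact Set.add_subset_add_left (Set.smul_set_mono hcZ)
  have hBM := EuclideanSpace.brunn_minkowski hn hK ((isCompact_zonotope s a).smul t) hKne
    (Set.Nonempty.smul_set ⟨0, zero_mem_zonotope s a⟩)
  have htq : volume.real (t • zonotope s a) ^ (n : ℝ)⁻¹ = t * q := by
    rw [EuclideanSpace.volume_real_smul ht.le, Real.mul_rpow (by positivity) measureReal_nonneg,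
      Real.pow_rpow_inv_natCast ht.le hn]
  rw [← hp, htq] at hBM
  have h1 := pow_add_mul_pow_mul_le hp0 (by positivity : 0 ≤ t * q) n
  have h2 := volume_add_zonotope_le hK hc s (fun i => t • a i)
  rw [← smul_zonotope] at h2
  have h3 : ∑ i ∈ s, 2 * ‖t • a i‖ * projVolume (K + t • zonotope s a) (t • a i) ≤
      t * ((1 + c * t) ^ (n - 1) * ∑ i ∈ s, 2 * ‖a i‖ * projVolume K (a i)) := by
    rw [Finset.mul_sum, Finset.mul_sum]
    refine Finset.sum_le_sum fun i hi => ?_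
    have h4 := projVolume_mono hsub (hK.smul _) (a i)
    rw [projVolume_smul _ (ha i hi) (by positivity)] at h4
    rw [projVolume_smul_right _ _ ht.ne', norm_smul, Real.norm_of_nonneg ht.le]
    calc 2 * (t * ‖a i‖) * projVolume (K + t • zonotope s a) (a i)
        ≤ 2 * (t * ‖a i‖) * ((1 + c * t) ^ (n - 1) * projVolume K (a i)) := by gcongr
      _ = _ := by ring
  refine le_of_mul_le_mul_left ?_ ht
  calc t * (n * p ^ (n - 1) * q) = n * p ^ (n - 1) * (t * q) := by ring
    _ ≤ _ := by linarith

/-- The mixed volume of a zonotope with itself is its volume. -/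
theorem sum_projVolume_zonotope_le (s : Finset ι) (a : ι → EuclideanSpace ℝ (Fin n)) :
    ∑ i ∈ s, 2 * ‖a i‖ * projVolume (zonotope s a) (a i) ≤ n * volume.real (zonotope s a) := by
  have hZ := isCompact_zonotope s a
  have hZc := convex_zonotope s a
  refine le_of_forall_pos_le_one_add_mul_pow_mul (c := 1) (n - 1) fun t ht => ?_
  rw [one_mul]
  have h1 := le_volume_add_zonotope hZ hZc s (fun i => t • a i)
  -- By convexity Z + tZ = (1 + t)Z, so the growth of the volume in t is explicit.
  have h2 : volume.real (zonotope s a + t • zonotope s a) =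
      (1 + t) ^ n * volume.real (zonotope s a) := by
    rw [← EuclideanSpace.volume_real_smul (by positivity), hZc.add_smul zero_le_one ht.le, one_smul]
  rw [← smul_zonotope, h2] at h1
  have h3 : ∑ i ∈ s, 2 * ‖t • a i‖ * projVolume (zonotope s a) (t • a i) =
      t * ∑ i ∈ s, 2 * ‖a i‖ * projVolume (zonotope s a) (a i) := by
    rw [Finset.mul_sum]
    refine Finset.sum_congr rfl fun i hi => ?_
    rw [projVolume_smul_right _ _ ht.ne', norm_smul, Real.norm_of_nonneg ht.le]
    ring
  rw [h3] at h1
  have h4 := mul_le_mul_of_nonneg_right (one_add_pow_le ht.le n)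
    (measureReal_nonneg : 0 ≤ volume.real (zonotope s a))
  refine le_of_mul_le_mul_left ?_ ht
  linarith

end Minkowski

/-! ### The projection function as a cosine transform. -/

theorem LipschitzWith.lintegral_enorm_deriv_of_monotoneOn {φ : ℝ → ℝ} {C : ℝ≥0}
    (hφ : LipschitzWith C φ) {a b : ℝ} (hab : a ≤ b) (hmono : MonotoneOn φ (Set.Icc a b)) :
    ∫⁻ t in Set.Ioc a b, ‖deriv φ t‖ₑ = ENNReal.ofReal (φ b - φ a) := by
  -- Absolute continuity gives the fundamental theorem of calculus; monotonicity makes the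
  -- derivative nonnegative on the open interval.
  have hac : AbsolutelyContinuousOnInterval φ a b :=
    (hφ.lipschitzOnWith (s := Set.uIcc a b)).absolutelyContinuousOnInterval
  have hint : IntegrableOn (deriv φ) (Set.Ioo a b) :=
    ((intervalIntegrable_iff_integrableOn_Ioc_of_le hab).1 hac.intervalIntegrable_deriv).mono_set
      Set.Ioo_subset_Ioc_self
  have hnn : ∀ t ∈ Set.Ioo a b, 0 ≤ deriv φ t := by
    intro t ht
    have hn : Set.Icc a b ∈ nhds t := Icc_mem_nhds ht.1 ht.2
    rw [← derivWithin_of_mem_nhds hn]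
    exact hmono.derivWithin_nonneg
  rw [← hac.integral_deriv_eq_sub, intervalIntegral.integral_of_le hab,
    ← integral_Icc_eq_integral_Ioc, integral_Icc_eq_integral_Ioo,
    ofReal_integral_eq_lintegral_ofReal hint
      (ae_restrict_of_forall_mem measurableSet_Ioo hnn),
    ← setLIntegral_congr Ioo_ae_eq_Ioc]
  refine setLIntegral_congr_fun measurableSet_Ioo fun t ht => ?_
  rw [Real.enorm_of_nonneg (hnn t ht)]

/-- The total variation of a compactly supported quasiconcave function is twice its maximum. -/
theorem LipschitzWith.lintegral_enorm_deriv_of_quasiconcave {φ : ℝ → ℝ} {C : ℝ≥0}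
    (hφ : LipschitzWith C φ) (hs : HasCompactSupport φ)
    (hq : ∀ x y z, x ≤ y → y ≤ z → min (φ x) (φ z) ≤ φ y) {t₀ : ℝ} (hmax : ∀ t, φ t ≤ φ t₀) :
    ∫⁻ t, ‖deriv φ t‖ₑ = 2 * ENNReal.ofReal (φ t₀) := by
  obtain ⟨R₀, hR₀⟩ := hs.isCompact.isBounded.subset_closedBall 0
  set R := max R₀ |t₀| + 1 with hR
  have hRt := le_max_right R₀ |t₀|
  have hRR := le_max_left R₀ |t₀|
  have ht1 : -R ≤ t₀ := by linarith [neg_abs_le t₀]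
  have ht2 : t₀ ≤ R := by linarith [le_abs_self t₀]
  have hout : ∀ t, t ∈ tsupport φ → -R < t ∧ t < R := by
    intro t ht
    have := hR₀ ht
    rw [mem_closedBall_zero_iff, Real.norm_eq_abs, abs_le] at this
    constructor <;> linarith [this.1, this.2]
  have hz1 : φ (-R) = 0 :=
    image_eq_zero_of_notMem_tsupport fun h => lt_irrefl _ (hout _ h).1
  have hz2 : φ R = 0 := image_eq_zero_of_notMem_tsupport fun h => lt_irrefl _ (hout _ h).2
  have hsub : Function.support (fun t => ‖deriv φ t‖ₑ) ⊆ Set.Ioc (-R) R := by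
    intro t ht
    have h1 : t ∈ Function.support (deriv φ) := by
      simpa using ht
    have h2 := hout t (support_deriv_subset h1)
    exact ⟨h2.1, h2.2.le⟩
  -- Quasiconcavity makes φ increase up to its maximum point and decrease after it, from 0 back to
  -- 0.
  have hm1 : MonotoneOn φ (Set.Icc (-R) t₀) := by
    intro x _ y hy hxy
    have := hq x y t₀ hxy hy.2
    rwa [min_eq_left (hmax x)] at this
  have hm2 : MonotoneOn (fun t => -φ t) (Set.Icc t₀ R) := by
    intro x hx y _ hxy
    have := hq t₀ x y hx.1 hxy
    rw [min_eq_right (hmax y)] at this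
    exact neg_le_neg this
  have e1 := hφ.lintegral_enorm_deriv_of_monotoneOn ht1 hm1
  have e2 := hφ.neg.lintegral_enorm_deriv_of_monotoneOn ht2 hm2
  have e3 : ∀ t, ‖deriv (-φ) t‖ₑ = ‖deriv φ t‖ₑ := fun t => by
    rw [deriv.neg, enorm_neg]
  simp only [e3, Pi.neg_apply] at e2
  rw [← setLIntegral_eq_of_support_subset hsub, ← Set.Ioc_union_Ioc_eq_Ioc ht1 ht2,
    lintegral_union measurableSet_Ioc (Set.Ioc_disjoint_Ioc_of_le le_rfl), e1, e2, hz1, hz2]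
  simp [two_mul]

/-- The function `x ↦ max 0 (1 - ‖x‖_K)`, where `‖·‖_K` is the gauge of `K`. -/
noncomputable def gaugeCone {n : ℕ} (K : Set (EuclideanSpace ℝ (Fin n)))
    (x : EuclideanSpace ℝ (Fin n)) : ℝ := max 0 (1 - gauge K x)

section GaugeCone

variable {n : ℕ} {K : Set (EuclideanSpace ℝ (Fin n))}

theorem exists_lipschitzWith_gaugeCone (hc : Convex ℝ K) (h0 : K ∈ nhds 0) :
    ∃ C, LipschitzWith C (gaugeCone K) := by
  obtain ⟨C, hC⟩ := hc.lipschitz_gauge h0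
  exact ⟨_, ((LipschitzWith.const (1 : ℝ)).sub hC).const_max 0⟩

theorem hasCompactSupport_gaugeCone (hK : IsCompact K) (hc : Convex ℝ K) (h0 : K ∈ nhds 0) :
    HasCompactSupport (gaugeCone K) := by
  refine HasCompactSupport.intro hK fun x hx => ?_
  refine max_eq_left ?_
  by_contra! h
  exact hx (interior_subset ((gauge_lt_one_iff_mem_interior hc h0).1 (by linarith)))

/-- The gauge is convex, so the cone is quasiconcave, in particular along every line. -/
theorem min_le_gaugeCone (hc : Convex ℝ K) (h0 : K ∈ nhds 0) (x z : EuclideanSpace ℝ (Fin n))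
    {p q : ℝ} (hp : 0 ≤ p) (hq : 0 ≤ q) (hpq : p + q = 1) :
    min (gaugeCone K x) (gaugeCone K z) ≤ gaugeCone K (p • x + q • z) := by
  have h1 := gauge_add_le hc (absorbent_nhds_zero h0) (p • x) (q • z)
  rw [gauge_smul_of_nonneg hp, gauge_smul_of_nonneg hq] at h1
  simp only [smul_eq_mul] at h1
  unfold gaugeCone
  rw [← max_min_distrib_left]
  refine max_le_max le_rfl ?_
  rcases le_total (gauge K x) (gauge K z) with h | h
  · refine (min_le_right _ _).trans ?_
    have : p * gauge K x ≤ p * gauge K z := mul_le_mul_of_nonneg_left h hp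
    have e : p * gauge K z + q * gauge K z = gauge K z := by rw [← add_mul, hpq, one_mul]
    linarith
  · refine (min_le_left _ _).trans ?_
    have : q * gauge K z ≤ q * gauge K x := mul_le_mul_of_nonneg_left h hq
    have e : p * gauge K x + q * gauge K x = gauge K x := by rw [← add_mul, hpq, one_mul]
    linarith

/-- For s > 0 the truncation at 0 plays no role, and for s < 1 the dilation is invertible;
closedness of K allows the weak inequality. -/
theorem le_gaugeCone_iff (hK : IsCompact K) (hc : Convex ℝ K) (h0 : K ∈ nhds 0) {s : ℝ}
    (hs0 : 0 < s) (hs1 : s < 1) (x : EuclideanSpace ℝ (Fin n)) :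
    s ≤ gaugeCone K x ↔ x ∈ (1 - s) • K := by
  have hs : 0 < 1 - s := by linarith
  have h1 := gauge_le_one_iff_mem_closure hc h0 (x := (1 - s)⁻¹ • x)
  rw [hK.isClosed.closure_eq, ← Set.mem_smul_set_iff_inv_smul_mem₀ hs.ne',
    gauge_smul_of_nonneg (inv_nonneg.2 hs.le), smul_eq_mul, inv_mul_le_one₀ hs] at h1
  rw [← h1, gaugeCone, le_max_iff]
  constructor
  · rintro (h | h) <;> linarith
  · intro h
    right
    linarith

theorem gaugeCone_le_one (x : EuclideanSpace ℝ (Fin n)) : gaugeCone K x ≤ 1 :=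
  max_le zero_le_one (by linarith [gauge_nonneg (s := K) x])

theorem gaugeCone_nonneg (x : EuclideanSpace ℝ (Fin n)) : 0 ≤ gaugeCone K x := le_max_left _ _

theorem exists_forall_gaugeCone_le (hK : IsCompact K) (hc : Convex ℝ K) (h0 : K ∈ nhds 0)
    {u : EuclideanSpace ℝ (Fin n)} (hu : ‖u‖ = 1) (y : EuclideanSpace ℝ (Fin n)) :
    HasCompactSupport (fun t : ℝ => gaugeCone K (y + t • u)) ∧
      ∃ t₀ : ℝ, ∀ t : ℝ, gaugeCone K (y + t • u) ≤ gaugeCone K (y + t₀ • u) := by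
  obtain ⟨C, hC⟩ := exists_lipschitzWith_gaugeCone hc h0
  have hemb : Topology.IsClosedEmbedding fun t : ℝ => y + t • u := by
    refine Isometry.isClosedEmbedding (Isometry.of_dist_eq fun a b => ?_)
    rw [dist_add_left, dist_eq_norm, ← sub_smul, norm_smul, hu, mul_one, dist_eq_norm]
  have hs : HasCompactSupport (fun t : ℝ => gaugeCone K (y + t • u)) :=
    (hasCompactSupport_gaugeCone hK hc h0).comp_isClosedEmbedding hemb
  refine ⟨hs, ?_⟩
  have hcont : Continuous (fun t : ℝ => gaugeCone K (y + t • u)) :=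
    hC.continuous.comp hemb.continuous
  obtain ⟨t₀, ht₀⟩ := hcont.exists_forall_ge_of_hasCompactSupport hs
  exact ⟨t₀, ht₀⟩

theorem lintegral_enorm_deriv_gaugeCone (hK : IsCompact K) (hc : Convex ℝ K) (h0 : K ∈ nhds 0)
    {u : EuclideanSpace ℝ (Fin n)} (hu : ‖u‖ = 1) (y : EuclideanSpace ℝ (Fin n)) :
    ∫⁻ t : ℝ, ‖deriv (fun t : ℝ => gaugeCone K (y + t • u)) t‖ₑ =
      2 * ENNReal.ofReal (⨆ t : ℝ, gaugeCone K (y + t • u)) := by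
  obtain ⟨C, hC⟩ := exists_lipschitzWith_gaugeCone hc h0
  obtain ⟨hs, t₀, ht₀⟩ := exists_forall_gaugeCone_le hK hc h0 hu y
  have hlip : LipschitzWith 1 fun t : ℝ => y + t • u := by
    refine (Isometry.of_dist_eq fun a b => ?_).lipschitz
    rw [dist_add_left, dist_eq_norm, ← sub_smul, norm_smul, hu, mul_one, dist_eq_norm]
  have hsup : ⨆ t : ℝ, gaugeCone K (y + t • u) = gaugeCone K (y + t₀ • u) :=
    le_antisymm (ciSup_le ht₀) (le_ciSup (f := fun t : ℝ => gaugeCone K (y + t • u))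
      ⟨_, by rintro _ ⟨t, rfl⟩; exact ht₀ t⟩ t₀)
  rw [hsup]
  refine (hC.comp hlip).lintegral_enorm_deriv_of_quasiconcave hs (fun a b c hab hbc => ?_) ht₀
  have hb : b ∈ segment ℝ a c := by
    rw [segment_eq_Icc (hab.trans hbc)]; exact ⟨hab, hbc⟩
  obtain ⟨p, q, hp, hq, hpq, rfl⟩ := hb
  have := min_le_gaugeCone hc h0 (y + a • u) (y + c • u) hp hq hpq
  have e : y + (p • a + q • c) • u = p • (y + a • u) + q • (y + c • u) := by
    have hy' : y = (p + q) • y := by rw [hpq, one_smul]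
    conv_lhs => rw [hy']
    simp only [smul_eq_mul]
    module
  exact this.trans_eq (congrArg (gaugeCone K) e.symm)

/-- Layer cake: the maximum on the line through y reaches s exactly when the line meets (1 - s)K,
that is, when y lies in the projection of (1 - s)K. -/
theorem lintegral_iSup_gaugeCone (hK : IsCompact K) (hc : Convex ℝ K) (h0 : K ∈ nhds 0)
    {u : EuclideanSpace ℝ (Fin n)} (hu : ‖u‖ = 1) :
    ∫⁻ y : (Submodule.span ℝ {u})ᗮ,
        ENNReal.ofReal (⨆ t : ℝ, gaugeCone K ((y : EuclideanSpace ℝ (Fin n)) + t • u)) =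
      (∫⁻ s in Set.Ioo (0 : ℝ) 1, ENNReal.ofReal ((1 - s) ^ (n - 1))) *
        ENNReal.ofReal (projVolume K u) := by
  obtain ⟨C, hC⟩ := exists_lipschitzWith_gaugeCone hc h0
  have hbdd : ∀ y : (Submodule.span ℝ {u})ᗮ, BddAbove (Set.range fun t : ℝ =>
      gaugeCone K ((y : EuclideanSpace ℝ (Fin n)) + t • u)) := fun y =>
    ⟨1, by rintro _ ⟨t, rfl⟩; exact gaugeCone_le_one _⟩
  have hmeas : Measurable fun y : (Submodule.span ℝ {u})ᗮ =>
      ⨆ t : ℝ, gaugeCone K ((y : EuclideanSpace ℝ (Fin n)) + t • u) := by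
    refine LowerSemicontinuous.measurable (lowerSemicontinuous_ciSup hbdd fun t => ?_)
    exact (hC.continuous.comp (by fun_prop)).lowerSemicontinuous
  rw [lintegral_eq_lintegral_meas_le volume
    (.of_forall fun y => Real.iSup_nonneg fun t => gaugeCone_nonneg _) hmeas.aemeasurable]
  have hzero : ∀ s : ℝ, 1 < s → volume {y : (Submodule.span ℝ {u})ᗮ |
      s ≤ ⨆ t : ℝ, gaugeCone K ((y : EuclideanSpace ℝ (Fin n)) + t • u)} = 0 := by
    intro s hs
    convert measure_empty (μ := (volume : Measure (Submodule.span ℝ {u})ᗮ))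
    ext y
    simp only [Set.mem_ofPred_eq, Set.mem_empty_iff_false, iff_false, not_le]
    exact (ciSup_le fun t => gaugeCone_le_one _).trans_lt hs
  rw [← Set.Ioc_union_Ioi_eq_Ioi (zero_le_one' ℝ), lintegral_union measurableSet_Ioi
    (Set.Ioc_disjoint_Ioi le_rfl), setLIntegral_congr_fun measurableSet_Ioi hzero, lintegral_zero,
    add_zero, ← setLIntegral_congr Ioo_ae_eq_Ioc, ← lintegral_mul_const' _ _ ENNReal.ofReal_ne_top]
  refine setLIntegral_congr_fun measurableSet_Ioo fun s hs => ?_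
  have hs' : 0 ≤ 1 - s := by linarith [hs.2]
  have hu0 : u ≠ 0 := by
    rintro rfl
    simp at hu
  have hset : {y : (Submodule.span ℝ {u})ᗮ |
      s ≤ ⨆ t : ℝ, gaugeCone K ((y : EuclideanSpace ℝ (Fin n)) + t • u)} =
      (Submodule.span ℝ {u})ᗮ.orthogonalProjectionOnto '' ((1 - s) • K) := by
    ext y
    rw [mem_orthogonalProjectionOnto_image_iff]
    simp only [Set.mem_ofPred_eq, ← le_gaugeCone_iff hK hc h0 hs.1 hs.2]
    constructor
    · intro h
      obtain ⟨t₀, ht₀⟩ := (exists_forall_gaugeCone_le hK hc h0 hu y).2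
      exact ⟨t₀, h.trans (ciSup_le ht₀)⟩
    · rintro ⟨t, ht⟩
      exact ht.trans (le_ciSup (hbdd y) t)
  have hfin : volume ((Submodule.span ℝ {u})ᗮ.orthogonalProjectionOnto '' ((1 - s) • K)) ≠ ∞ :=
    ((hK.smul (1 - s)).image (ContinuousLinearMap.continuous _)).measure_lt_top.ne
  simp only [hset]
  rw [← ENNReal.ofReal_mul (by positivity), ← projVolume_smul K hu0 hs']
  exact (ENNReal.ofReal_toReal hfin).symm

theorem lintegral_enorm_lineDeriv_gaugeCone (hK : IsCompact K) (hc : Convex ℝ K)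
    (h0 : K ∈ nhds 0) {u : EuclideanSpace ℝ (Fin n)} (hu : ‖u‖ = 1) :
    ∫⁻ x, ‖lineDeriv ℝ (gaugeCone K) x u‖ₑ =
      2 * (∫⁻ s in Set.Ioo (0 : ℝ) 1, ENNReal.ofReal ((1 - s) ^ (n - 1))) *
        ENNReal.ofReal (projVolume K u) := by
  obtain ⟨C, hC⟩ := exists_lipschitzWith_gaugeCone hc h0
  rw [lintegral_eq_lintegral_orthogonal hu (measurable_lineDeriv hC.continuous).enorm, mul_assoc,
    ← lintegral_iSup_gaugeCone hK hc h0 hu, ← lintegral_const_mul' _ _ (by simp)]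
  refine lintegral_congr fun y => ?_
  rw [← lintegral_enorm_deriv_gaugeCone hK hc h0 hu]
  refine lintegral_congr fun t => ?_
  have e : lineDeriv ℝ (gaugeCone K) ((y : EuclideanSpace ℝ (Fin n)) + t • u) u =
      deriv (fun t : ℝ => gaugeCone K ((y : EuclideanSpace ℝ (Fin n)) + t • u)) t := by
    have := deriv_comp_const_add
      (fun t : ℝ => gaugeCone K ((y : EuclideanSpace ℝ (Fin n)) + t • u)) t 0
    rw [add_zero] at this
    rw [← this, lineDeriv]
    simp only [add_smul, add_assoc]
  rw [e]

/-- The projection function of a convex body is the cosine transform of an integrable vector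
field. -/
theorem exists_integrable_projVolume_eq (hK : IsCompact K) (hc : Convex ℝ K)
    (hi : (interior K).Nonempty) :
    ∃ G : EuclideanSpace ℝ (Fin n) → EuclideanSpace ℝ (Fin n), Integrable G ∧
      ∀ θ : EuclideanSpace ℝ (Fin n), ‖θ‖ = 1 → projVolume K θ = ∫ x, |inner ℝ θ (G x)| := by
  wlog h0 : K ∈ nhds 0 generalizing K
  · obtain ⟨x, hx⟩ := hi
    have hx' : (-x +ᵥ K) ∈ nhds (0 : EuclideanSpace ℝ (Fin n)) := by
      rw [mem_interior_iff_mem_nhds] at hx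
      have := vadd_mem_nhds_vadd (-x) hx
      simpa using this
    obtain ⟨G, hG, h⟩ := this (hK.vadd (-x)) (hc.vadd (-x))
      ⟨0, mem_interior_iff_mem_nhds.2 hx'⟩ hx'
    exact ⟨G, hG, fun θ hθ => by rw [← h θ hθ, projVolume_vadd]⟩
  obtain ⟨C, hC⟩ := exists_lipschitzWith_gaugeCone hc h0
  set κ := 2 * (∫⁻ s in Set.Ioo (0 : ℝ) 1, ENNReal.ofReal ((1 - s) ^ (n - 1))) with hκ
  have hκt : κ ≠ ∞ := by
    refine ENNReal.mul_ne_top (by simp) (ne_top_of_le_ne_top ENNReal.one_ne_top ?_)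
    calc ∫⁻ s in Set.Ioo (0 : ℝ) 1, ENNReal.ofReal ((1 - s) ^ (n - 1))
        ≤ ∫⁻ s in Set.Ioo (0 : ℝ) 1, 1 := by
          refine setLIntegral_mono measurable_const fun s hs => ?_
          rw [ENNReal.ofReal_le_one]
          exact pow_le_one₀ (by linarith [hs.2]) (by linarith [hs.1])
      _ = 1 := by simp
  have hκ0 : κ ≠ 0 := by
    refine mul_ne_zero (by simp) (ne_of_gt ?_)
    rw [setLIntegral_pos_iff (by fun_prop)]
    have : Function.support (fun s : ℝ => ENNReal.ofReal ((1 - s) ^ (n - 1))) ∩ Set.Ioo 0 1 =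
        Set.Ioo 0 1 := by
      refine Set.inter_eq_right.2 fun s hs => ?_
      have : (0 : ℝ) < 1 - s := by linarith [hs.2]
      simp only [Function.mem_support, ne_eq, ENNReal.ofReal_eq_zero, not_le]
      positivity
    rw [this]
    simp
  have hκr : κ.toReal ≠ 0 := (ENNReal.toReal_pos hκ0 hκt).ne'
  have hsupp := hasCompactSupport_gaugeCone hK hc h0
  have hgm : Measurable (gradient (gaugeCone K)) :=
    (InnerProductSpace.toDual ℝ (EuclideanSpace ℝ (Fin n))).symm.continuous.measurable.comp
      (measurable_fderiv ℝ (gaugeCone K))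
  have hgi : Integrable (gradient (gaugeCone K)) := by
    have hdom : Integrable ((tsupport (gaugeCone K)).indicator fun _ => (C : ℝ)) :=
      (integrable_indicator_iff hsupp.isCompact.isClosed.measurableSet).2
        (integrableOn_const hsupp.isCompact.measure_lt_top.ne)
    refine hdom.mono' hgm.aestronglyMeasurable (.of_forall fun x => ?_)
    rw [gradient, LinearIsometryEquiv.norm_map]
    by_cases hx : x ∈ tsupport (gaugeCone K)
    · rw [Set.indicator_of_mem hx]
      exact norm_fderiv_le_of_lipschitz ℝ hC
    · rw [Set.indicator_of_notMem hx, fderiv_of_notMem_tsupport ℝ hx, norm_zero]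
  -- The factor κ relating ∫ |∂_θ f| to the projection volume is the same for all θ, so one rescaled
  -- gradient serves every direction.
  refine ⟨fun x => κ.toReal⁻¹ • gradient (gaugeCone K) x, hgi.smul κ.toReal⁻¹, fun θ hθ => ?_⟩
  have h1 : ∫ x, |inner ℝ θ (gradient (gaugeCone K) x)| = κ.toReal * projVolume K θ := by
    have h2 := integral_norm_eq_lintegral_enorm (μ := volume)
      (f := fun x => inner ℝ θ (gradient (gaugeCone K) x))
      (hgi.const_inner θ).aestronglyMeasurable
    simp only [Real.norm_eq_abs] at h2
    have h3 : ∫⁻ x, ‖inner ℝ θ (gradient (gaugeCone K) x)‖ₑ =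
        ∫⁻ x, ‖lineDeriv ℝ (gaugeCone K) x θ‖ₑ := by
      refine lintegral_congr_ae ?_
      -- Rademacher's theorem.
      filter_upwards [hC.ae_differentiableAt (μ := volume)] with x hx
      rw [hx.lineDeriv_eq_fderiv, real_inner_comm, gradient,
        InnerProductSpace.toDual_symm_apply]
    rw [h2, h3, lintegral_enorm_lineDeriv_gaugeCone hK hc h0 hθ, ← hκ, ENNReal.toReal_mul,
      ENNReal.toReal_ofReal (projVolume_nonneg _ _)]
  simp only [inner_smul_right, abs_mul, abs_of_nonneg (inv_nonneg.2 ENNReal.toReal_nonneg)]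
  rw [integral_const_mul, h1, inv_mul_cancel_left₀ hκr]

end GaugeCone

/-! ### Approximation of projection bodies by zonotopes. -/

/-- The bound does not depend on θ, so L¹ approximation of the field is uniform approximation on the
sphere. -/
theorem abs_integral_abs_inner_sub_le {α E : Type*} [MeasurableSpace α] {μ : Measure α}
    [NormedAddCommGroup E] [InnerProductSpace ℝ E] {f g : α → E} (hf : Integrable f μ)
    (hg : Integrable g μ) {θ : E} (hθ : ‖θ‖ = 1) :
    |(∫ x, |inner ℝ θ (f x)| ∂μ) - ∫ x, |inner ℝ θ (g x)| ∂μ| ≤ ∫ x, ‖f x - g x‖ ∂μ := by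
  have hf' : Integrable (fun x => |inner ℝ θ (f x)|) μ := (hf.const_inner θ).abs
  have hg' : Integrable (fun x => |inner ℝ θ (g x)|) μ := (hg.const_inner θ).abs
  rw [← integral_sub hf' hg']
  refine (norm_integral_le_integral_norm _).trans
    (integral_mono (hf'.sub hg').norm (hf.sub hg).norm fun x => ?_)
  calc ‖|inner ℝ θ (f x)| - |inner ℝ θ (g x)|‖
      ≤ |inner ℝ θ (f x) - inner ℝ θ (g x)| := abs_abs_sub_abs_le _ _
    _ = |inner ℝ θ (f x - g x)| := by rw [inner_sub_right]
    _ ≤ ‖θ‖ * ‖f x - g x‖ := abs_real_inner_le_norm _ _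
    _ = ‖f x - g x‖ := by rw [hθ, one_mul]

/-- Cosine transforms of integrable vector fields are uniform limits of support functions of
zonotopes. -/
theorem exists_zonotope_approx {n : ℕ} {G : EuclideanSpace ℝ (Fin n) → EuclideanSpace ℝ (Fin n)}
    (hG : Integrable G) {δ : ℝ} (hδ : 0 < δ) :
    ∃ (s : Finset (EuclideanSpace ℝ (Fin n)))
      (a : EuclideanSpace ℝ (Fin n) → EuclideanSpace ℝ (Fin n)), (∀ i ∈ s, a i ≠ 0) ∧
      ∀ θ : EuclideanSpace ℝ (Fin n), ‖θ‖ = 1 →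
        |(∫ x, |inner ℝ θ (G x)|) - ∑ i ∈ s, (|inner ℝ θ (a i)| : ℝ)| ≤ δ := by
  classical
  obtain ⟨S, hS, hSm⟩ := (memLp_one_iff_integrable.2 hG).exists_simpleFunc_eLpNorm_sub_lt
    ENNReal.one_ne_top (ε := ENNReal.ofReal δ) (by simpa using hδ)
  have hSi : Integrable S := memLp_one_iff_integrable.1 hSm
  -- Each value v of S contributes |⟨θ, v⟩| times the volume of its level set, hence the segment
  -- generated by v scaled by that volume. Zero generators, which have no direction, are dropped.
  refine ⟨S.range.filter fun v => volume.real (S ⁻¹' {v}) • v ≠ 0,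
    fun v => volume.real (S ⁻¹' {v}) • v, fun i hi => (Finset.mem_filter.1 hi).2,
    fun θ hθ => ?_⟩
  have hsum : ∑ v ∈ S.range with volume.real (S ⁻¹' {v}) • v ≠ 0,
      |inner ℝ θ (volume.real (S ⁻¹' {v}) • v)| = ∫ x, |inner ℝ θ (S x)| := by
    have h1 : ∫ x, |inner ℝ θ (S x)| = ∫ x, (S.map fun v => |inner ℝ θ v|) x := rfl
    have h2 : Integrable (S.map fun v => |inner ℝ θ v|) := (hSi.const_inner θ).abs
    rw [h1, ← SimpleFunc.integral_eq_integral _ h2, SimpleFunc.map_integral _ _ hSi (by simp),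
      Finset.sum_filter_of_ne]
    · refine Finset.sum_congr rfl fun v _ => ?_
      rw [inner_smul_right, abs_mul, abs_of_nonneg measureReal_nonneg, smul_eq_mul]
    · intro v _ hv h
      rw [h] at hv
      simp at hv
  rw [hsum]
  refine (abs_integral_abs_inner_sub_le hG hSi hθ).trans ?_
  have e : ∫ x, ‖G x - S x‖ = (∫⁻ x, ‖G x - S x‖ₑ).toReal :=
    integral_norm_eq_lintegral_enorm (hG.sub hSi).aestronglyMeasurable
  rw [e]
  rw [eLpNorm_one_eq_lintegral_enorm] at hS
  exact ENNReal.toReal_le_of_le_ofReal hδ.le hS.le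

/-- Hahn–Banach separates a point outside B from B; normalising the functional gives a unit θ that
violates the comparison. -/
theorem subset_of_forall_exists_inner_le {E : Type*} [NormedAddCommGroup E]
    [InnerProductSpace ℝ E] [CompleteSpace E] {A B : Set E} (hB : IsClosed B) (hc : Convex ℝ B)
    (hne : B.Nonempty)
    (h : ∀ θ : E, ‖θ‖ = 1 → ∀ x ∈ A, ∃ y ∈ B, inner ℝ θ x ≤ inner ℝ θ y) : A ⊆ B := by
  intro x hx
  by_contra hxB
  obtain ⟨f, c, hf, hfx⟩ := geometric_hahn_banach_closed_point hc hB hxB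
  obtain ⟨v, rfl⟩ := (InnerProductSpace.toDual ℝ E).surjective f
  simp only [InnerProductSpace.toDual_apply_apply] at hf hfx
  obtain ⟨y₀, hy₀⟩ := hne
  have hv : v ≠ 0 := by
    rintro rfl
    have := hf y₀ hy₀
    simp only [inner_zero_left] at this hfx
    linarith
  have hv0 : 0 < ‖v‖⁻¹ := inv_pos.2 (norm_pos_iff.2 hv)
  obtain ⟨y, hy, hxy⟩ := h (‖v‖⁻¹ • v) (by
    rw [norm_smul, norm_inv, norm_norm, inv_mul_cancel₀ (norm_ne_zero_iff.2 hv)]) x hx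
  rw [real_inner_smul_left, real_inner_smul_left] at hxy
  have := le_of_mul_le_mul_left hxy hv0
  linarith [hf y hy]

section Ball

variable {n : ℕ}

theorem orthogonalProjectionOnto_image_closedBall (u : EuclideanSpace ℝ (Fin n)) (r : ℝ) :
    (Submodule.span ℝ {u})ᗮ.orthogonalProjectionOnto '' Metric.closedBall 0 r =
      Metric.closedBall 0 r := by
  ext y
  constructor
  · rintro ⟨x, hx, rfl⟩
    rw [mem_closedBall_zero_iff] at hx ⊢
    exact (Submodule.norm_orthogonalProjectionOnto_apply_le _ x).trans hx
  · intro hy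
    refine ⟨y, ?_, Submodule.orthogonalProjectionOnto_mem_subspace_eq_self y⟩
    simpa using hy

theorem projVolume_closedBall_one {u : EuclideanSpace ℝ (Fin n)} (hu : u ≠ 0) :
    projVolume (Metric.closedBall 0 1) u =
      volume.real (Metric.closedBall (0 : EuclideanSpace ℝ (Fin (n - 1))) 1) := by
  have hfr : Module.finrank ℝ (Submodule.span ℝ {u})ᗮ = n - 1 := by
    have h1 := (Submodule.span ℝ {u}).finrank_add_finrank_orthogonal
    rw [finrank_span_singleton hu, finrank_euclideanSpace_fin] at h1
    omega
  let e := ((stdOrthonormalBasis ℝ (Submodule.span ℝ {u})ᗮ).reindex (finCongr hfr)).repr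
  have he := e.measurePreserving.measure_preimage
    (Metric.isClosed_closedBall (x := (0 : EuclideanSpace ℝ (Fin (n - 1))))
      (ε := 1)).measurableSet.nullMeasurableSet
  rw [LinearIsometryEquiv.preimage_closedBall, map_zero] at he
  rw [projVolume, orthogonalProjectionOnto_image_closedBall, measureReal_def, he, measureReal_def]

theorem volume_real_closedBall_one_pos :
    0 < volume.real (Metric.closedBall (0 : EuclideanSpace ℝ (Fin n)) 1) :=
  ENNReal.toReal_pos (Metric.measure_closedBall_pos _ _ one_pos).ne'
    measure_closedBall_lt_top.ne

end Ball

/-- A convex body whose support function is the projection function of a convex body is, up to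
dilations close to `1`, a zonotope. -/
theorem exists_zonotope_between {n : ℕ} {L M : Set (EuclideanSpace ℝ (Fin n))}
    (hL : IsCompact L) (hLc : Convex ℝ L) (hL0 : 0 ∈ interior L)
    (hM : IsCompact M) (hMc : Convex ℝ M) (hMi : (interior M).Nonempty)
    (hLM : ∀ θ : EuclideanSpace ℝ (Fin n), ‖θ‖ = 1 →
      IsLUB ((fun y => inner ℝ θ y) '' L) (projVolume M θ)) {η : ℝ} (hη : 0 < η) (hη1 : η < 1) :
    ∃ (s : Finset (EuclideanSpace ℝ (Fin n)))
      (a : EuclideanSpace ℝ (Fin n) → EuclideanSpace ℝ (Fin n)), (∀ i ∈ s, a i ≠ 0) ∧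
      (1 - η) • L ⊆ zonotope s a ∧ zonotope s a ⊆ (1 + η) • L := by
  have hLne : L.Nonempty := ⟨0, interior_subset hL0⟩
  obtain ⟨r, hr, hrL⟩ := Metric.nhds_basis_closedBall.mem_iff.1 (mem_interior_iff_mem_nhds.1 hL0)
  obtain ⟨G, hG, hGM⟩ := exists_integrable_projVolume_eq hM hMc hMi
  -- Since L contains the ball of radius r, its support function is at least r on the sphere, so the
  -- additive error ηr is a relative error η.
  obtain ⟨s, a, ha, hsa⟩ := exists_zonotope_approx hG (mul_pos hη hr)
  refine ⟨s, a, ha, ?_⟩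
  have hr' : ∀ θ : EuclideanSpace ℝ (Fin n), ‖θ‖ = 1 → r ≤ projVolume M θ := by
    intro θ hθ
    have := (hLM θ hθ).1 ⟨r • θ, hrL (by
      rw [mem_closedBall_zero_iff, norm_smul, hθ, mul_one, Real.norm_of_nonneg hr.le]), rfl⟩
    simpa [inner_smul_right, real_inner_self_eq_norm_sq, hθ] using this
  have hclose : ∀ θ : EuclideanSpace ℝ (Fin n), ‖θ‖ = 1 →
      (1 - η) * projVolume M θ ≤ ∑ i ∈ s, |inner ℝ θ (a i)| ∧
      ∑ i ∈ s, |inner ℝ θ (a i)| ≤ (1 + η) * projVolume M θ := by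
    intro θ hθ
    have h1 := hsa θ hθ
    rw [← hGM θ hθ, abs_le] at h1
    have h2 := mul_le_mul_of_nonneg_left (hr' θ hθ) hη.le
    constructor <;> linarith [h1.1, h1.2]
  constructor
  · refine subset_of_forall_exists_inner_le (isCompact_zonotope s a).isClosed
      (convex_zonotope s a) ⟨0, zero_mem_zonotope s a⟩ fun θ hθ x hx => ?_
    obtain ⟨x, hx, rfl⟩ := hx
    obtain ⟨y, hy, hye⟩ := exists_mem_zonotope_inner_eq s a θ
    refine ⟨y, hy, ?_⟩
    rw [hye]
    refine le_trans ?_ (hclose θ hθ).1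
    simp only [inner_smul_right]
    exact mul_le_mul_of_nonneg_left ((hLM θ hθ).1 ⟨x, hx, rfl⟩) (by linarith)
  · refine subset_of_forall_exists_inner_le (hL.smul _).isClosed (hLc.smul _)
      hLne.smul_set fun θ hθ x hx => ?_
    have hcont : Continuous fun y : EuclideanSpace ℝ (Fin n) => inner ℝ θ y := by fun_prop
    obtain ⟨y, hy, hye⟩ := (hL.image hcont).isClosed.closure_eq ▸
      (hLM θ hθ).mem_closure (hLne.image _)
    refine ⟨(1 + η) • y, ⟨y, hy, rfl⟩, ?_⟩
    simp only at hye
    rw [inner_smul_right, hye]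
    exact (inner_le_of_mem_zonotope hx θ).trans (hclose θ hθ).2

theorem le_of_forall_one_sub_pow_mul_le {X Y : ℝ} (m : ℕ)
    (h : ∀ η : ℝ, 0 < η → η < 1 → (1 - η) ^ m * X ≤ (1 + η) ^ m * Y) : X ≤ Y := by
  have h1 : Filter.Tendsto (fun t : ℝ => (1 - t) ^ m * X) (nhdsWithin 0 (Set.Ioi 0))
      (nhds X) := by
    have : ContinuousAt (fun t : ℝ => (1 - t) ^ m * X) 0 := by fun_prop
    simpa using this.tendsto.mono_left nhdsWithin_le_nhds
  have h2 : Filter.Tendsto (fun t : ℝ => (1 + t) ^ m * Y) (nhdsWithin 0 (Set.Ioi 0))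
      (nhds Y) := by
    have : ContinuousAt (fun t : ℝ => (1 + t) ^ m * Y) 0 := by fun_prop
    simpa using this.tendsto.mono_left nhdsWithin_le_nhds
  refine le_of_tendsto_of_tendsto h1 h2 ?_
  filter_upwards [Ioo_mem_nhdsGT (zero_lt_one' ℝ)] with t ht
  exact h t ht.1 ht.2

/-! ### The separation inequality. -/

/-- The stability estimate in Shephard's problem, with volumes normalised to be `1`-homogeneous. -/
theorem shephard_separation {n : ℕ} (hn : n ≠ 0) {K L M : Set (EuclideanSpace ℝ (Fin n))}
    (hK : IsCompact K) (hKc : Convex ℝ K) (hK0 : 0 ∈ interior K)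
    (hL : IsCompact L) (hLc : Convex ℝ L) (hL0 : 0 ∈ interior L)
    (hM : IsCompact M) (hMc : Convex ℝ M) (hMi : (interior M).Nonempty)
    (hLM : ∀ θ : EuclideanSpace ℝ (Fin n), ‖θ‖ = 1 →
      IsLUB ((fun y => inner ℝ θ y) '' L) (projVolume M θ)) {ε : ℝ} (hε : 0 < ε)
    (h : ∀ ξ : EuclideanSpace ℝ (Fin n), ‖ξ‖ = 1 → projVolume K ξ ≤ projVolume L ξ - ε) :
    (volume.real K ^ (n : ℝ)⁻¹) ^ (n - 1) +
        (volume.real (Metric.closedBall (0 : EuclideanSpace ℝ (Fin n)) 1) ^ (n : ℝ)⁻¹) ^ (n - 1) /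
          volume.real (Metric.closedBall (0 : EuclideanSpace ℝ (Fin (n - 1))) 1) * ε ≤
      (volume.real L ^ (n : ℝ)⁻¹) ^ (n - 1) := by
  refine le_of_forall_one_sub_pow_mul_le (n - 1) fun η hη hη1 => ?_
  obtain ⟨s, a, ha, hLZ, hZL⟩ := exists_zonotope_between hL hLc hL0 hM hMc hMi hLM hη hη1
  set β := volume.real (Metric.closedBall (0 : EuclideanSpace ℝ (Fin (n - 1))) 1) with hβ
  have hβ0 : 0 < β := volume_real_closedBall_one_pos
  have hZ := isCompact_zonotope s a
  have h1η : 0 < 1 - η := by linarith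
  have hi := minkowski_first_inequality_zonotope hn hK hKc hK0 s ha
  -- The source of the constant: for the ball the sum is β ∑ 2‖a i‖, so this bounds the total length
  -- of the segments from below.
  have hii := minkowski_first_inequality_zonotope hn
    (isCompact_closedBall (0 : EuclideanSpace ℝ (Fin n)) 1) (convex_closedBall _ _)
    (mem_interior_iff_mem_nhds.2 (Metric.closedBall_mem_nhds _ one_pos)) s ha
  have hiii := sum_projVolume_zonotope_le s a
  have hLpos : 0 < volume.real L :=
    ENNReal.toReal_pos (Measure.measure_pos_of_nonempty_interior _ ⟨0, hL0⟩).ne' hL.measure_lt_top.ne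
  have hvol1 : (1 - η) ^ n * volume.real L ≤ volume.real (zonotope s a) := by
    rw [← EuclideanSpace.volume_real_smul h1η.le]
    exact measureReal_mono hLZ hZ.measure_lt_top.ne
  have hvol2 : volume.real (zonotope s a) ≤ (1 + η) ^ n * volume.real L := by
    rw [← EuclideanSpace.volume_real_smul (by positivity)]
    exact measureReal_mono hZL (hL.smul _).measure_lt_top.ne
  set p := volume.real K ^ (n : ℝ)⁻¹
  set b := volume.real (Metric.closedBall (0 : EuclideanSpace ℝ (Fin n)) 1) ^ (n : ℝ)⁻¹
  set l := volume.real L ^ (n : ℝ)⁻¹ with hl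
  set z := volume.real (zonotope s a) ^ (n : ℝ)⁻¹ with hz
  have hzn : z ^ n = volume.real (zonotope s a) :=
    Real.rpow_inv_natCast_pow measureReal_nonneg hn
  have hz0 : 0 < z := Real.rpow_pos_of_pos (lt_of_lt_of_le (by positivity) hvol1) _
  have hzl : z ≤ (1 + η) * l := by
    have := Real.rpow_le_rpow measureReal_nonneg hvol2 (by positivity : 0 ≤ (n : ℝ)⁻¹)
    rwa [Real.mul_rpow (by positivity) hLpos.le, Real.pow_rpow_inv_natCast (by positivity) hn]
      at this
  have hball : ∑ i ∈ s, 2 * ‖a i‖ * projVolume (Metric.closedBall 0 1) (a i) =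
      (∑ i ∈ s, 2 * ‖a i‖) * β := by
    rw [Finset.sum_mul]
    exact Finset.sum_congr rfl fun i hi => by rw [projVolume_closedBall_one (ha i hi)]
  rw [hball] at hii
  -- The hypothesis in the direction of each a i, weighted by 2‖a i‖ and summed; projections of L
  -- pass to those of Z through (1 - η)L ⊆ Z.
  have hcomp : (1 - η) ^ (n - 1) * ∑ i ∈ s, 2 * ‖a i‖ * projVolume K (a i) ≤
      ∑ i ∈ s, 2 * ‖a i‖ * projVolume (zonotope s a) (a i) -
        (1 - η) ^ (n - 1) * (ε * ∑ i ∈ s, 2 * ‖a i‖) := by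
    rw [Finset.mul_sum, Finset.mul_sum, Finset.mul_sum, ← Finset.sum_sub_distrib]
    refine Finset.sum_le_sum fun i hi => ?_
    have hai : ‖a i‖ ≠ 0 := norm_ne_zero_iff.2 (ha i hi)
    have h1 := h (‖a i‖⁻¹ • a i) (by rw [norm_smul, norm_inv, norm_norm, inv_mul_cancel₀ hai])
    rw [projVolume_smul_right _ _ (inv_ne_zero hai),
      projVolume_smul_right _ _ (inv_ne_zero hai)] at h1
    have h2 := projVolume_mono hLZ hZ (a i)
    rw [projVolume_smul _ (ha i hi) h1η.le] at h2
    have h3 : (1 - η) ^ (n - 1) * projVolume K (a i) ≤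
        projVolume (zonotope s a) (a i) - (1 - η) ^ (n - 1) * ε := by
      have := mul_le_mul_of_nonneg_left h1 (pow_nonneg h1η.le (n - 1))
      rw [mul_sub] at this
      linarith
    have h4 := mul_le_mul_of_nonneg_left h3 (by positivity : 0 ≤ 2 * ‖a i‖)
    linarith
  set A := ∑ i ∈ s, 2 * ‖a i‖ with hA
  set μ := (1 - η) ^ (n - 1) with hμ
  have hμ0 : 0 < μ := pow_pos h1η _
  have hn0 : (0 : ℝ) < n := by positivity
  have hA' : n * (b ^ (n - 1) / β) * z ≤ A := by
    rw [← div_le_iff₀ hβ0] at hii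
    refine le_trans (le_of_eq ?_) hii
    ring
  have hzz : z ^ n = z ^ (n - 1) * z := by
    rw [← pow_succ, Nat.sub_add_cancel (Nat.one_le_iff_ne_zero.2 hn)]
  rw [← hzn, hzz] at hiii
  -- Both uses of Minkowski's inequality and the bound n z^n carry the factor n z, which then
  -- cancels.
  have hfin : (μ * (p ^ (n - 1) + b ^ (n - 1) / β * ε)) * (n * z) ≤ z ^ (n - 1) * (n * z) := by
    have h5 := mul_le_mul_of_nonneg_left hi hμ0.le
    have h6 := mul_le_mul_of_nonneg_left hA' (mul_pos hμ0 hε).le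
    linarith
  refine (le_of_mul_le_mul_right hfin (by positivity)).trans ?_
  rw [← mul_pow]
  exact pow_le_pow_left₀ hz0.le hzl _

/-! ### Convex bodies, balls and sharpness. -/

section ConvexBody

variable {n : ℕ}

theorem ConvexBody.zero_mem_interior {K : ConvexBody (EuclideanSpace ℝ (Fin n))}
    (hi : K.HasInterior) (hs : K.OriginSymmetric) :
    0 ∈ interior (K : Set (EuclideanSpace ℝ (Fin n))) := by
  obtain ⟨x, hx⟩ := hi
  have := K.convex.combo_interior_self_mem_interior hx (hs x (interior_subset hx))
    (by norm_num : (0 : ℝ) < 1 / 2) (by norm_num : (0 : ℝ) ≤ 1 / 2) (by norm_num)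
  simpa using this

theorem ConvexBody.isLUB_supportFn (L : ConvexBody (EuclideanSpace ℝ (Fin n)))
    (θ : EuclideanSpace ℝ (Fin n)) :
    IsLUB ((fun y => inner ℝ θ y) '' (L : Set (EuclideanSpace ℝ (Fin n)))) (L.supportFn θ) :=
  isLUB_csSup (L.nonempty.image _) (L.isCompact.image (by fun_prop)).bddAbove

theorem Real.rpow_sub_one_div_natCast (hn : n ≠ 0) {x : ℝ} (hx : 0 ≤ x) :
    x ^ (((n : ℝ) - 1) / n) = (x ^ (n : ℝ)⁻¹) ^ (n - 1) := by
  rw [← Real.rpow_natCast, ← Real.rpow_mul hx, Nat.cast_sub (Nat.one_le_iff_ne_zero.2 hn),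
    Nat.cast_one, inv_mul_eq_div]

/-- The Euclidean ball of radius `r` about the origin as a convex body. -/
def ConvexBody.euclideanBall (n : ℕ) {r : ℝ} (hr : 0 < r) :
    ConvexBody (EuclideanSpace ℝ (Fin n)) where
  carrier := Metric.closedBall 0 r
  convex' := convex_closedBall 0 r
  isCompact' := isCompact_closedBall 0 r
  nonempty' := ⟨0, Metric.mem_closedBall_self hr.le⟩

variable {r : ℝ} (hr : 0 < r)

theorem ConvexBody.coe_euclideanBall :
    (ConvexBody.euclideanBall n hr : Set (EuclideanSpace ℝ (Fin n))) = Metric.closedBall 0 r := rfl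

theorem ConvexBody.coe_euclideanBall_eq_smul :
    (ConvexBody.euclideanBall n hr : Set (EuclideanSpace ℝ (Fin n))) =
      r • Metric.closedBall 0 1 := by
  rw [smul_unitClosedBall, Real.norm_of_nonneg hr.le, ConvexBody.coe_euclideanBall]

theorem ConvexBody.hasInterior_euclideanBall : (ConvexBody.euclideanBall n hr).HasInterior :=
  ⟨0, mem_interior_iff_mem_nhds.2 (Metric.closedBall_mem_nhds _ hr)⟩

theorem ConvexBody.originSymmetric_euclideanBall :
    (ConvexBody.euclideanBall n hr).OriginSymmetric := by
  intro x hx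
  have hx' : x ∈ Metric.closedBall 0 r := hx
  change -x ∈ Metric.closedBall 0 r
  simpa using hx'

theorem ConvexBody.vol_euclideanBall :
    (ConvexBody.euclideanBall n hr).vol =
      r ^ n * volume.real (Metric.closedBall (0 : EuclideanSpace ℝ (Fin n)) 1) := by
  rw [ConvexBody.vol, ConvexBody.coe_euclideanBall_eq_smul, EuclideanSpace.volume_real_smul hr.le]

theorem ConvexBody.projVol_euclideanBall {ξ : EuclideanSpace ℝ (Fin n)} (hξ : ‖ξ‖ = 1) :
    (ConvexBody.euclideanBall n hr).projVol ξ =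
      r ^ (n - 1) * volume.real (Metric.closedBall (0 : EuclideanSpace ℝ (Fin (n - 1))) 1) := by
  have hξ0 : ξ ≠ 0 := by
    rintro rfl
    simp at hξ
  rw [← projVolume_closedBall_one hξ0, ← projVolume_smul _ hξ0 hr.le,
    ← ConvexBody.coe_euclideanBall_eq_smul hr]
  rfl

theorem ConvexBody.supportFn_euclideanBall_one {θ : EuclideanSpace ℝ (Fin n)} (hθ : ‖θ‖ = 1) :
    (ConvexBody.euclideanBall n one_pos).supportFn θ = 1 := by
  refine IsGreatest.csSup_eq ⟨⟨θ, ?_, ?_⟩, ?_⟩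
  · simp [ConvexBody.coe_euclideanBall, hθ]
  · simp [hθ]
  · rintro _ ⟨y, hy, rfl⟩
    rw [ConvexBody.coe_euclideanBall, mem_closedBall_zero_iff] at hy
    refine (real_inner_le_norm θ y).trans ?_
    rw [hθ, one_mul]
    exact hy

theorem ConvexBody.isProjectionBody_euclideanBall_one (hn : 2 ≤ n) :
    (ConvexBody.euclideanBall n one_pos).IsProjectionBody := by
  set β := volume.real (Metric.closedBall (0 : EuclideanSpace ℝ (Fin (n - 1))) 1) with hβ
  have hβ0 : 0 < β := volume_real_closedBall_one_pos
  -- The radius ρ solves ρ^(n-1) β = 1; the root exists because n ≥ 2, whereas for n = 1 projection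
  -- volumes ignore the radius.
  have hρ : 0 < (β⁻¹) ^ ((n - 1 : ℕ) : ℝ)⁻¹ := by positivity
  refine ⟨ConvexBody.euclideanBall n hρ, ConvexBody.hasInterior_euclideanBall hρ, fun θ hθ => ?_⟩
  rw [ConvexBody.supportFn_euclideanBall_one hθ, ConvexBody.projVol_euclideanBall hρ hθ,
    Real.rpow_inv_natCast_pow (by positivity) (by omega), inv_mul_cancel₀ hβ0.ne']

end ConvexBody

theorem theorem1 (n : ℕ) (hn : 1 ≤ n) :
    (∀ (ε : ℝ), 0 < ε → ∀ K L : ConvexBody (EuclideanSpace ℝ (Fin n)),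
      K.HasInterior → K.OriginSymmetric → L.HasInterior → L.OriginSymmetric →
      L.IsProjectionBody →
      (∀ ξ : EuclideanSpace ℝ (Fin n), ‖ξ‖ = 1 → K.projVol ξ ≤ L.projVol ξ - ε) →
      K.vol ^ (((n : ℝ) - 1) / n) ≤ L.vol ^ (((n : ℝ) - 1) / n) - sepConst n * ε) ∧
    -- the constant is the best possible one
    (2 ≤ n → ∀ c : ℝ,
      (∀ (ε : ℝ), 0 < ε → ∀ K L : ConvexBody (EuclideanSpace ℝ (Fin n)),
        K.HasInterior → K.OriginSymmetric → L.HasInterior → L.OriginSymmetric →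
        L.IsProjectionBody →
        (∀ ξ : EuclideanSpace ℝ (Fin n), ‖ξ‖ = 1 → K.projVol ξ ≤ L.projVol ξ - ε) →
        K.vol ^ (((n : ℝ) - 1) / n) ≤ L.vol ^ (((n : ℝ) - 1) / n) - c * ε) →
      c ≤ sepConst n) := by
  have hn0 : n ≠ 0 := by omega
  refine ⟨fun ε hε K L hKi hKs hLi hLs ⟨M, hMi, hLM⟩ h => ?_, fun hn2 c hc => ?_⟩
  · have key := shephard_separation hn0 K.isCompact K.convex (K.zero_mem_interior hKi hKs)
      L.isCompact L.convex (L.zero_mem_interior hLi hLs) M.isCompact M.convex hMi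
      (fun θ hθ => by
        have := L.isLUB_supportFn θ
        rw [hLM θ hθ] at this
        exact this) hε h
    simp only [ConvexBody.vol, sepConst,
      Real.rpow_sub_one_div_natCast hn0 (measureReal_nonneg (μ := volume))]
    linarith
  · set β := volume.real (Metric.closedBall (0 : EuclideanSpace ℝ (Fin (n - 1))) 1) with hβ
    have hβ0 : 0 < β := volume_real_closedBall_one_pos
    have hδ : (0 : ℝ) < 1 - (1 / 2) ^ (n - 1) :=
      sub_pos.2 (pow_lt_one₀ (by norm_num) (by norm_num) (by omega))
    have h2 : (0 : ℝ) < 1 / 2 := by norm_num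
    -- For the balls of radius 1/2 and 1 the projection volumes differ by exactly this ε, so the
    -- assumed inequality becomes, after division by 1 - (1/2)^(n-1), the bound on c.
    have key := hc ((1 - (1 / 2) ^ (n - 1)) * β) (mul_pos hδ hβ0)
      (ConvexBody.euclideanBall n h2) (ConvexBody.euclideanBall n one_pos)
      (ConvexBody.hasInterior_euclideanBall _) (ConvexBody.originSymmetric_euclideanBall _)
      (ConvexBody.hasInterior_euclideanBall _) (ConvexBody.originSymmetric_euclideanBall _)
      (ConvexBody.isProjectionBody_euclideanBall_one hn2) (fun ξ hξ => by
        rw [ConvexBody.projVol_euclideanBall _ hξ, ConvexBody.projVol_euclideanBall _ hξ,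
          one_pow, ← hβ]
        exact le_of_eq (by ring))
    rw [ConvexBody.vol_euclideanBall, ConvexBody.vol_euclideanBall, one_pow, one_mul,
      Real.mul_rpow (by positivity) measureReal_nonneg,
      Real.rpow_sub_one_div_natCast hn0 (by positivity),
      Real.pow_rpow_inv_natCast h2.le hn0] at key
    rw [sepConst, ← hβ, le_div_iff₀ hβ0]
    refine le_of_mul_le_mul_left ?_ hδ
    linarith
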